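/- Let $H=H^2(\mathbb R^4)$ be the completion of the real Schwartz space $\mathcal S(\mathbb R^4)$ under $(f_1,f_2)_H=\int_{\mathbb R^4}(I-\Delta)^2f_1(x)\,f_2(x)\,dx$. Let $\Theta$ be a real separable Banach space with a continuous injective linear embedding of $H$ onto a dense subspace, and let $\mathcal W$ be a Borel probability measure on $\Theta$ such that $(H,\Theta,\mathcal W)$ is an abstract Wiener space, i.e. $\mathbb E^{\mathcal W}[e^{i\langle\cdot,x^*\rangle}]=e^{-\|h_{x^*}\|_H^2/2}$ for every $x^*\in\Theta^*$, where $h_{x^*}\in H$ is determined by $(h,h_{x^*})_H=\langle h,x^*\rangle$ for all $h\in H$. Let $\mathcal I:H\to L^2(\mathcal W)$ be the Paley–Wiener map, the unique linear isometry with $\mathcal I(h_{x^*})=\langle\cdot,x^*\rangle$ for all $x^*\in\Theta^*$. For a tempered distribution $\nu\in H^{-2}(\mathbb R^4)$ (i.e. one that is bounded for $\|\cdot\|_H$) let $h_\nu\in H$ be the unique element with $(h,h_\nu)_H=\langle h,\nu\rangle$ for all $h\in H$. For $x\in\mathbb R^4$ and $\epsilon>0$ let $\sigma^x_\epsilon$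 be the average over the sphere $S_\epsilon(x)$ of centre $x$ and radius $\epsilon$, $\langle f,\sigma^x_\epsilon\rangle=\frac1{2\pi^2\epsilon^3}\int_{S_\epsilon(x)}f\,d\sigma$, let $\langle f,d\sigma^x_\epsilon\rangle=\frac{d}{d\epsilon}\langle f,\sigma^x_\epsilon\rangle$ for $f\in\mathcal S(\mathbb R^4)$, and put $$\mu^x_\epsilon=(1,1)\,\mathbf B(\epsilon)^{-1}\begin{pmatrix}\sigma^x_\epsilon\\ d\sigma^x_\epsilon\end{pmatrix},\qquad \mathbf B(r)=\begin{pmatrix}I_1(r)/r& I_1'(r)\\ I_2(r)/r& I_1''(r)\end{pmatrix},$$ where $I_k$ is the modified Bessel function of the first kind of order $k$. Fix $\epsilon>0$. Then $\mu_\epsilon^x\in H^{-2}(\mathbb R^4)$ for every $x\in\mathbb R^4$, and the map $x\in\mathbb R^4\mapsto\mathcal I(h_{\mu^x_\epsilon})\in L^2(\mathcal W)$ is continuous. Moreover, there is a choice of measurable representatives $\theta\mapsto\mathcal I(h_{\mu^x_\epsilon})(\theta)$ of the classes $\mathcal I(h_{\mu^x_\epsilon})$, $x\in\mathbb R^4$,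 such that for every $\alpha\in(0,\tfrac12)$ and for $\mathcal W$-almost every $\theta\in\Theta$ the function $x\in\mathbb R^4\mapsto\mathcal I(h_{\mu^x_\epsilon})(\theta)\in\mathbb R$ is locally Hölder continuous with exponent $\alpha$, that is, $\alpha$-Hölder continuous on every compact subset of $\mathbb R^4$ (with a constant that may depend on the compact set and on $\theta$). -/

import Mathlib

open MeasureTheory ProbabilityTheory Set Filter Topology
open scoped NNReal ENNReal SchwartzMap Nat Laplacian

noncomputable section

namespace GFF4

/-- Euclidean space `ℝ⁴`. -/
abbrev R4 : Type := EuclideanSpace ℝ (Fin 4)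

/-! ### The Hilbert space `H = H²(ℝ⁴)` -/

/-- The operator `I - Δ` on real-valued Schwartz functions. -/
def bessel (f : 𝓢(R4, ℝ)) : 𝓢(R4, ℝ) := f - Δ f

lemma bessel_add (f g : 𝓢(R4, ℝ)) : bessel (f + g) = bessel f + bessel g := by
  have h : Δ (f + g) = Δ f + Δ g := (LineDeriv.laplacianCLM ℝ R4 𝓢(R4, ℝ)).map_add f g
  simp only [bessel, h]
  abel

lemma bessel_smul (c : ℝ) (f : 𝓢(R4, ℝ)) : bessel (c • f) = c • bessel f := by
  have h : Δ (c • f) = c • Δ f := (LineDeriv.laplacianCLM ℝ R4 𝓢(R4, ℝ)).map_smul c f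
  simp only [bessel, h, smul_sub]

lemma integrable_mul (f g : 𝓢(R4, ℝ)) : Integrable (fun x => f x * g x) :=
  (SchwartzMap.pairing (ContinuousLinearMap.mul ℝ ℝ) f g).integrable

lemma integral_bessel_mul (f g : 𝓢(R4, ℝ)) :
    ∫ x, bessel f x * g x = ∫ x, f x * bessel g x := by
  simp only [bessel, sub_apply, sub_mul, mul_sub]
  rw [integral_sub (integrable_mul f g) (integrable_mul (Δ f) g),
    integral_sub (integrable_mul f g) (integrable_mul f (Δ g)),
    SchwartzMap.integral_mul_laplacian_right_eq_left]

/-- The inner product `(f₁, f₂)_H = ∫ (I - Δ)² f₁ · f₂` on Schwartz functions. -/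
def schwartzInner (f g : 𝓢(R4, ℝ)) : ℝ := ∫ x, bessel (bessel f) x * g x

lemma schwartzInner_eq (f g : 𝓢(R4, ℝ)) :
    schwartzInner f g = ∫ x, bessel f x * bessel g x :=
  integral_bessel_mul (bessel f) g

/-- A copy of the real Schwartz space `𝓢(ℝ⁴)`, to carry the inner product of `H` in place of the
Schwartz topology. -/
def PreH : Type := 𝓢(R4, ℝ)

instance : AddCommGroup PreH := inferInstanceAs (AddCommGroup 𝓢(R4, ℝ))
instance : Module ℝ PreH := inferInstanceAs (Module ℝ 𝓢(R4, ℝ))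

/-- The identity map from `𝓢(ℝ⁴)` to its copy. -/
def toPreH : 𝓢(R4, ℝ) ≃ₗ[ℝ] PreH := LinearEquiv.refl ℝ 𝓢(R4, ℝ)

instance preHCore : PreInnerProductSpace.Core ℝ PreH where
  inner f g := schwartzInner (toPreH.symm f) (toPreH.symm g)
  conj_inner_symm f g := by
    simp only [schwartzInner_eq, conj_trivial, mul_comm]
  re_inner_nonneg f := by
    simp only [schwartzInner_eq, RCLike.re_to_real]
    exact integral_nonneg fun x => mul_self_nonneg _
  add_left f g h := by
    simp only [schwartzInner_eq, map_add, bessel_add, add_apply, add_mul]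
    exact integral_add (integrable_mul _ _) (integrable_mul _ _)
  smul_left f g r := by
    simp only [schwartzInner_eq, map_smul, bessel_smul, smul_apply, smul_eq_mul,
      conj_trivial, mul_assoc]
    exact integral_const_mul _ _

instance : SeminormedAddCommGroup PreH :=
  InnerProductSpace.Core.toSeminormedAddCommGroup (𝕜 := ℝ)

instance : InnerProductSpace ℝ PreH := InnerProductSpace.ofCore preHCore

/-- The Sobolev space `H = H²(ℝ⁴)`: the completion of the real Schwartz space under
`(f₁, f₂)_H = ∫ (I - Δ)² f₁ · f₂`. -/
abbrev H : Type := UniformSpace.Completion PreH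

/-- The canonical dense map `𝓢(ℝ⁴) → H`. -/
def toH : 𝓢(R4, ℝ) →ₗ[ℝ] H :=
  UniformSpace.Completion.toComplₗᵢ.toLinearMap ∘ₗ toPreH.toLinearMap

lemma inner_toH (f g : 𝓢(R4, ℝ)) :
    inner ℝ (toH f) (toH g) = ∫ x, bessel (bessel f) x * g x :=
  UniformSpace.Completion.inner_coe (𝕜 := ℝ) (toPreH f) (toPreH g)

lemma denseRange_toH : DenseRange toH :=
  UniformSpace.Completion.denseRange_coe.comp toPreH.surjective.denseRange
    (UniformSpace.Completion.continuous_coe PreH)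

/-- For a real tempered distribution `ν` that is bounded for the norm of `H`, that is `ν ∈ H⁻²`,
`riesz ν` is the element `h_ν` of `H` with `(h, h_ν)_H = ⟨h, ν⟩` for all `h ∈ H`, where `⟨·, ν⟩` is
extended from `𝓢(ℝ⁴)` to `H` by continuity (the value is `0` if `ν ∉ H⁻²`). -/
def riesz (ν : 𝓢(R4, ℝ) →L[ℝ] ℝ) : H :=
  (InnerProductSpace.toDual ℝ H).symm ((ν : 𝓢(R4, ℝ) →ₗ[ℝ] ℝ).extendOfNorm toH)

/-- The defining property of `h_ν` for `ν ∈ H⁻²`. -/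
lemma inner_toH_riesz {ν : 𝓢(R4, ℝ) →L[ℝ] ℝ} (hν : ∃ C, ∀ f, ‖ν f‖ ≤ C * ‖toH f‖)
    (f : 𝓢(R4, ℝ)) : inner ℝ (toH f) (riesz ν) = ν f := by
  rw [real_inner_comm, riesz, InnerProductSpace.toDual_symm_apply]
  exact LinearMap.extendOfNorm_eq denseRange_toH hν f

/-! ### Spherical averages and their radial derivatives -/

/-- The surface measure of the unit sphere of `ℝ⁴`; its total mass is `2π²`. -/
abbrev sphereMeasure : Measure (Metric.sphere (0 : R4) 1) := (volume : Measure R4).toSphere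

lemma integrable_sphere {g : R4 → ℝ} (hg : Continuous g) (x : R4) (r : ℝ) :
    Integrable (fun u : Metric.sphere (0 : R4) 1 => g (x + r • (u : R4))) sphereMeasure := by
  have hc : Continuous fun u : Metric.sphere (0 : R4) 1 => g (x + r • (u : R4)) := by fun_prop
  exact hc.integrable_of_hasCompactSupport (HasCompactSupport.of_compactSpace _)

/-- The mean value `(2π²ε³)⁻¹ ∫_{S_ε(x)} f dσ`, parametrized by `y = x + ε u` with `|u| = 1`. -/
def sphereMean (x : R4) (ε : ℝ) (f : 𝓢(R4, ℝ)) : ℝ :=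
  (2 * Real.pi ^ 2)⁻¹ * ∫ u : Metric.sphere (0 : R4) 1, f (x + ε • (u : R4)) ∂sphereMeasure

lemma sphereMean_add (x : R4) (ε : ℝ) (f g : 𝓢(R4, ℝ)) :
    sphereMean x ε (f + g) = sphereMean x ε f + sphereMean x ε g := by
  simp only [sphereMean, add_apply]
  rw [integral_add (integrable_sphere f.continuous x ε) (integrable_sphere g.continuous x ε),
    mul_add]

lemma sphereMean_smul (x : R4) (ε c : ℝ) (f : 𝓢(R4, ℝ)) :
    sphereMean x ε (c • f) = c * sphereMean x ε f := by
  simp only [sphereMean, smul_apply, smul_eq_mul, integral_const_mul]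
  ring

lemma hasDerivAt_sphereMean (x : R4) (ε : ℝ) (f : 𝓢(R4, ℝ)) :
    HasDerivAt (fun r => sphereMean x r f)
      ((2 * Real.pi ^ 2)⁻¹ * ∫ u : Metric.sphere (0 : R4) 1,
        fderiv ℝ f (x + ε • (u : R4)) (u : R4) ∂sphereMeasure) ε := by
  refine HasDerivAt.const_mul _ ?_
  have hbd : ∀ (y : R4) (u : Metric.sphere (0 : R4) 1),
      ‖fderiv ℝ f y (u : R4)‖ ≤ SchwartzMap.seminorm ℝ 0 1 f := fun y u => by
    refine (ContinuousLinearMap.le_opNorm _ _).trans ?_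
    have hu : ‖(u : R4)‖ = 1 := by simp
    rw [hu, mul_one, ← norm_iteratedFDeriv_one]
    exact SchwartzMap.norm_iteratedFDeriv_le_seminorm ℝ f 1 y
  have hf' : Continuous (fderiv ℝ f) := (f.smooth 1).continuous_fderiv one_ne_zero
  refine (hasDerivAt_integral_of_dominated_loc_of_deriv_le (s := univ)
    (F := fun r (u : Metric.sphere (0 : R4) 1) => f (x + r • (u : R4)))
    (F' := fun r u => fderiv ℝ f (x + r • (u : R4)) (u : R4))
    (bound := fun _ => SchwartzMap.seminorm ℝ 0 1 f) univ_mem ?_ ?_ ?_ ?_ ?_ ?_).2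
  · exact Eventually.of_forall fun r => (integrable_sphere f.continuous x r).aestronglyMeasurable
  · exact integrable_sphere f.continuous x ε
  · have hc : Continuous fun u : Metric.sphere (0 : R4) 1 =>
        fderiv ℝ f (x + ε • (u : R4)) (u : R4) := by fun_prop
    exact hc.aestronglyMeasurable
  · exact ae_of_all _ fun u r _ => hbd _ u
  · exact integrable_const _
  · refine ae_of_all _ fun u r _ => ?_
    have h1 : HasDerivAt (fun r : ℝ => x + r • (u : R4)) (u : R4) r := by
      simpa using ((hasDerivAt_id r).smul_const (u : R4)).const_add x
    exact (f.differentiableAt.hasFDerivAt).comp_hasDerivAt r h1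

lemma norm_sphereMean_le (x : R4) (ε : ℝ) (f : 𝓢(R4, ℝ)) :
    ‖sphereMean x ε f‖ ≤
      ‖(2 * Real.pi ^ 2)⁻¹‖ * sphereMeasure.real univ * SchwartzMap.seminorm ℝ 0 0 f := by
  rw [sphereMean, norm_mul, mul_assoc]
  gcongr
  rw [mul_comm]
  exact norm_integral_le_of_norm_le_const (ae_of_all _ fun u => f.norm_le_seminorm ℝ _)

lemma norm_deriv_sphereMean_le (x : R4) (ε : ℝ) (f : 𝓢(R4, ℝ)) :
    ‖deriv (fun r => sphereMean x r f) ε‖ ≤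
      ‖(2 * Real.pi ^ 2)⁻¹‖ * sphereMeasure.real univ * SchwartzMap.seminorm ℝ 0 1 f := by
  rw [(hasDerivAt_sphereMean x ε f).deriv, norm_mul, mul_assoc]
  gcongr
  rw [mul_comm]
  refine norm_integral_le_of_norm_le_const (ae_of_all _ fun u => ?_)
  refine (ContinuousLinearMap.le_opNorm _ _).trans ?_
  have hu : ‖(u : R4)‖ = 1 := by simp
  rw [hu, mul_one, ← norm_iteratedFDeriv_one]
  exact SchwartzMap.norm_iteratedFDeriv_le_seminorm ℝ f 1 _

/-- The tempered distribution `σ_ε^x`: the average over the sphere `S_ε(x)`. -/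
def sigma (x : R4) (ε : ℝ) : 𝓢(R4, ℝ) →L[ℝ] ℝ :=
  SchwartzMap.mkCLMtoNormedSpace (sphereMean x ε) (sphereMean_add x ε) (sphereMean_smul x ε)
    ⟨{(0, 0)}, ‖(2 * Real.pi ^ 2)⁻¹‖ * sphereMeasure.real univ, by positivity, fun f => by
      rw [Finset.sup_singleton]
      exact norm_sphereMean_le x ε f⟩

/-- The tempered distribution `dσ_ε^x`, given by `⟨f, dσ_ε^x⟩ = d/dε ⟨f, σ_ε^x⟩`. -/
def dsigma (x : R4) (ε : ℝ) : 𝓢(R4, ℝ) →L[ℝ] ℝ :=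
  SchwartzMap.mkCLMtoNormedSpace (fun f => deriv (fun r => sigma x r f) ε)
    (fun f g => by
      simp only [map_add]
      exact deriv_fun_add (hasDerivAt_sphereMean x ε f).differentiableAt
        (hasDerivAt_sphereMean x ε g).differentiableAt)
    (fun c f => by
      simp only [map_smul]
      exact deriv_const_mul c (hasDerivAt_sphereMean x ε f).differentiableAt)
    ⟨{(0, 1)}, ‖(2 * Real.pi ^ 2)⁻¹‖ * sphereMeasure.real univ, by positivity, fun f => by
      rw [Finset.sup_singleton]
      exact norm_deriv_sphereMean_le x ε f⟩

/-- The modified Bessel function of the first kind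
`I_k(r) = ∑ₘ (r/2)^(2m+k) / (m! (m+k)!)` of order `k ∈ ℕ`. -/
def besselI (k : ℕ) (r : ℝ) : ℝ :=
  ∑' m : ℕ, (r / 2) ^ (2 * m + k) / ((m ! : ℝ) * ((m + k)! : ℝ))

/-- The matrix `B(r) = (I₁(r)/r, I₁'(r); I₂(r)/r, I₁''(r))`. -/
def matB (r : ℝ) : Matrix (Fin 2) (Fin 2) ℝ :=
  !![besselI 1 r / r, deriv (besselI 1) r;
     besselI 2 r / r, deriv (deriv (besselI 1)) r]

/-- The row vector `ζᵀ B(ε)⁻¹` with `ζ = (1, 1)ᵀ`. -/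
def coeff (ε : ℝ) : Fin 2 → ℝ := Matrix.vecMul ![1, 1] (matB ε)⁻¹

/-- The tempered distribution `μ_ε^x = ζᵀ B(ε)⁻¹ (σ_ε^x, dσ_ε^x)ᵀ` with `ζ = (1, 1)ᵀ`. -/
def mu (x : R4) (ε : ℝ) : 𝓢(R4, ℝ) →L[ℝ] ℝ :=
  coeff ε 0 • sigma x ε + coeff ε 1 • dsigma x ε

/-! ### Abstract Wiener spaces and Paley-Wiener integrals -/

section AbstractWiener

variable {K Θ : Type*} [NormedAddCommGroup K] [InnerProductSpace ℝ K] [CompleteSpace K]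
  [NormedAddCommGroup Θ] [NormedSpace ℝ Θ]

/-- For an embedding `ι` of a Hilbert space `K` into `Θ` and `x* ∈ Θ*`, the element `h_{x*}` of `K`
with `(h, h_{x*})_K = ⟨ι h, x*⟩` for all `h ∈ K`. -/
def dualRep (ι : K →L[ℝ] Θ) : StrongDual ℝ Θ →ₗ[ℝ] K where
  toFun x' := (InnerProductSpace.toDual ℝ K).symm (x'.comp ι)
  map_add' a b := by simp [ContinuousLinearMap.add_comp]
  map_smul' c a := by simp [ContinuousLinearMap.smul_comp]

lemma inner_dualRep (ι : K →L[ℝ] Θ) (x' : StrongDual ℝ Θ) (h : K) :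
    inner ℝ h (dualRep ι x') = x' (ι h) := by
  rw [real_inner_comm]
  simp [dualRep, InnerProductSpace.toDual_symm_apply]

lemma denseRange_dualRep {ι : K →L[ℝ] Θ} (hι : Function.Injective ι) :
    DenseRange (dualRep ι) := by
  have h : (LinearMap.range (dualRep ι)).topologicalClosure = ⊤ := by
    rw [Submodule.topologicalClosure_eq_top_iff, Submodule.eq_bot_iff]
    intro k hk
    rw [Submodule.mem_orthogonal'] at hk
    have hk0 : ι k = 0 := SeparatingDual.eq_zero_of_forall_dual_eq_zero (R := ℝ) fun x' => by
      rw [← inner_dualRep]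
      exact hk _ ⟨x', rfl⟩
    exact hι (by simpa using hk0)
  have := (Submodule.dense_iff_topologicalClosure_eq_top).2 h
  rwa [LinearMap.coe_range] at this

variable [MeasurableSpace Θ]

/-- `(K, Θ, W)` is an abstract Wiener space, where the Hilbert space `K` is embedded into the Banach
space `Θ` by `ι`. -/
structure IsAbstractWienerSpace (ι : K →L[ℝ] Θ) (W : Measure Θ) : Prop where
  isProbabilityMeasure : IsProbabilityMeasure W
  injective : Function.Injective ι
  denseRange : DenseRange ι
  integral_exp : ∀ x' : StrongDual ℝ Θ,
    ∫ θ, Complex.exp (Complex.I * (x' θ : ℂ)) ∂W =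
      Complex.exp (-((‖dualRep ι x'‖ ^ 2 / 2 : ℝ) : ℂ))

variable [BorelSpace Θ] {ι : K →L[ℝ] Θ} {W : Measure Θ}

namespace IsAbstractWienerSpace

lemma map_eq (hW : IsAbstractWienerSpace ι W) (x' : StrongDual ℝ Θ) :
    W.map x' = gaussianReal 0 (‖dualRep ι x'‖₊ ^ 2) := by
  have := hW.isProbabilityMeasure
  have : IsProbabilityMeasure (W.map x') :=
    Measure.isProbabilityMeasure_map x'.continuous.measurable.aemeasurable
  apply Measure.ext_of_charFun
  ext t
  rw [charFun_map_eq_charFunDual_smul, charFunDual_apply, charFun_gaussianReal]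
  have h := hW.integral_exp (t • x')
  simp only [mul_comm Complex.I] at h
  rw [h, map_smul, norm_smul, mul_pow]
  congr 1
  simp
  ring

lemma memLp (hW : IsAbstractWienerSpace ι W) (x' : StrongDual ℝ Θ) :
    MemLp (fun θ => x' θ) 2 W := by
  have h : MemLp id 2 (W.map x') := by
    rw [hW.map_eq x']
    exact memLp_id_gaussianReal' 2 (by simp)
  exact (memLp_map_measure_iff aestronglyMeasurable_id
    x'.continuous.measurable.aemeasurable).1 h

/-- The map `x* ↦ ⟨·, x*⟩ ∈ L²(W)`. -/
def evalLp (hW : IsAbstractWienerSpace ι W) : StrongDual ℝ Θ →ₗ[ℝ] Lp ℝ 2 W where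
  toFun x' := (hW.memLp x').toLp _
  map_add' a b := (MemLp.toLp_add (hW.memLp a) (hW.memLp b)).symm ▸ rfl
  map_smul' c a := (MemLp.toLp_const_smul c (hW.memLp a)).symm ▸ rfl

lemma norm_evalLp (hW : IsAbstractWienerSpace ι W) (x' : StrongDual ℝ Θ) :
    ‖hW.evalLp x'‖ = ‖dualRep ι x'‖ := by
  have := hW.isProbabilityMeasure
  have h1 : ‖hW.evalLp x'‖ ^ 2 = ∫ θ, x' θ ^ 2 ∂W := by
    rw [← real_inner_self_eq_norm_sq, L2.inner_def]
    refine integral_congr_ae ?_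
    filter_upwards [(hW.memLp x').coeFn_toLp] with θ hθ
    have hθ' : (hW.evalLp x' : Θ → ℝ) θ = x' θ := hθ
    simp [hθ', pow_two]
  have h2 : ∫ θ, x' θ ^ 2 ∂W = ‖dualRep ι x'‖ ^ 2 := by
    have h3 : ∫ y, y ^ 2 ∂(W.map x') = ∫ θ, x' θ ^ 2 ∂W :=
      integral_map x'.continuous.measurable.aemeasurable
        (by fun_prop : AEStronglyMeasurable (fun y : ℝ => y ^ 2) (W.map x'))
    rw [← h3, hW.map_eq x']
    have h4 := variance_fun_id_gaussianReal (μ := 0) (v := ‖dualRep ι x'‖₊ ^ 2)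
    rw [variance_eq_integral (by fun_prop)] at h4
    simpa [integral_id_gaussianReal] using h4
  have h5 := h1.trans h2
  exact (pow_left_inj₀ (norm_nonneg _) (norm_nonneg _) two_ne_zero).1 h5

/-- The Paley-Wiener map `𝓘 : K → L²(W)`: the unique linear isometry with
`𝓘(h_{x*}) = ⟨·, x*⟩` for all `x* ∈ Θ*`. -/
def paleyWiener (hW : IsAbstractWienerSpace ι W) : K →ₗᵢ[ℝ] Lp ℝ 2 W where
  toLinearMap := (hW.evalLp.extendOfNorm (dualRep ι)).toLinearMap
  norm_map' := by
    intro k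
    refine (denseRange_dualRep hW.injective).induction_on
      (p := fun k => ‖hW.evalLp.extendOfNorm (dualRep ι) k‖ = ‖k‖) k ?_ fun x' => ?_
    · exact isClosed_eq (by fun_prop) (by fun_prop)
    · rw [LinearMap.extendOfNorm_eq (denseRange_dualRep hW.injective)
        ⟨1, fun y => by rw [one_mul, hW.norm_evalLp]⟩, hW.norm_evalLp]

lemma paleyWiener_dualRep (hW : IsAbstractWienerSpace ι W) (x' : StrongDual ℝ Θ) :
    hW.paleyWiener (dualRep ι x') =ᵐ[W] fun θ => x' θ := by
  have h : hW.paleyWiener (dualRep ι x') = hW.evalLp x' :=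
    LinearMap.extendOfNorm_eq (denseRange_dualRep hW.injective)
      ⟨1, fun y => by rw [one_mul, hW.norm_evalLp]⟩ x'
  rw [h]
  exact (hW.memLp x').coeFn_toLp

end IsAbstractWienerSpace

end AbstractWiener

end GFF4

end

/-! Everything reduces to one estimate: `mu x ε` is bounded in `H⁻²` uniformly in `x`, and `‖riesz
(mu x ε) - riesz (mu y ε)‖ ≤ C √‖x - y‖`. Continuity into `L²(W)` is then immediate, as the
Paley–Wiener map is an isometry. The image of `h` has `p`-th moments bounded by those of a Gaussian
of standard deviation `‖h‖`, so increments have `p`-th moments of order `‖x - y‖ ^ (p / 2)` for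
every `p`. Kolmogorov–Chentsov in dimension 4 gives every Hölder exponent below `1/2 - 4/p`, hence
every `α < 1/2` as `p → ∞`.

For the estimate, both distributions are rewritten as integrals over the solid ball. By the
divergence theorem `dsigma x ε f` is a multiple of the integral of `Δ f` (`dsigma_apply_eq`), and
`sigma x ε f` is a multiple of the integral of `div (y f) = 4 f + y · ∇f` (`sigma_apply_eq`). The
norm of `H` controls `f`, `∇f` and `Δ f` in `L²` (`norm_toH_sq`), so by Cauchy–Schwarz it remains to
see how a Lipschitz kernel cut off at a ball moves in `L²` under translation. Its jump across the
sphere changes it on a set of volume `O(‖x - y‖)`, so its squared `L²` norm changes by `O(‖x - y‖)`.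
This is the source of the exponent `1/2` (`exists_setIntegral_ball_bound`).

The divergence theorem on balls is obtained without surface theory: integrate by parts against the
differentiable cutoff `(r² - |y|²)₊²`, pass to polar coordinates, and differentiate twice in `r`. -/

/-! ### A Kolmogorov–Chentsov continuity theorem on Euclidean space -/

namespace KolmogorovChentsov

variable {κ : Type*}

/-- The dyadic point `2⁻ᵏ z` of level `k`. -/
noncomputable def dyadicPoint (k : ℕ) (z : κ → ℤ) : EuclideanSpace ℝ κ :=
  WithLp.toLp 2 fun i => (z i : ℝ) / 2 ^ k

/-- The integer coordinates of the dyadic point of level `k` just below `s`. -/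
noncomputable def dyadicFloor (k : ℕ) (s : EuclideanSpace ℝ κ) : κ → ℤ := fun i => ⌊2 ^ k * s i⌋

lemma dyadicPoint_two_mul (k : ℕ) (z : κ → ℤ) :
    dyadicPoint (k + 1) (fun i => 2 * z i) = dyadicPoint k z := by
  ext i
  simp only [dyadicPoint]
  push_cast
  rw [pow_succ]
  field_simp

/-- The limit of `y` along the dyadic points below `s`. -/
noncomputable def dyadicLimit (y : EuclideanSpace ℝ κ → ℝ) (s : EuclideanSpace ℝ κ) : ℝ :=
  limsup (fun k => y (dyadicPoint k (dyadicFloor k s))) atTop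

/-- A `limsup` needs no convergence to be measurable, so the modification is measurable at every
point with no exceptional set. -/
lemma measurable_dyadicLimit {Ω : Type*} [MeasurableSpace Ω] {Y : EuclideanSpace ℝ κ → Ω → ℝ}
    (hY : ∀ s, Measurable (Y s)) (s : EuclideanSpace ℝ κ) :
    Measurable fun ω => dyadicLimit (fun s => Y s ω) s :=
  Measurable.limsup fun _ => hY _

variable [Fintype κ]

lemma norm_dyadicPoint_floor_sub_le (k : ℕ) (s : EuclideanSpace ℝ κ) :
    ‖dyadicPoint k (dyadicFloor k s) - s‖ ≤ √(Fintype.card κ) * (1 / 2) ^ k := by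
  rw [EuclideanSpace.norm_eq]
  refine Real.sqrt_le_iff.2 ⟨by positivity, ?_⟩
  rw [mul_pow, Real.sq_sqrt (by positivity)]
  have : ∀ i ∈ Finset.univ, ‖(dyadicPoint k (dyadicFloor k s) - s) i‖ ^ 2
      ≤ ((1 / 2 : ℝ) ^ k) ^ 2 := by
    intro i _
    have h0 : (0 : ℝ) < 2 ^ k := by positivity
    have h1 : (dyadicPoint k (dyadicFloor k s) - s) i = (⌊2 ^ k * s i⌋ - 2 ^ k * s i) / 2 ^ k := by
      simp only [dyadicPoint, dyadicFloor, PiLp.sub_apply]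
      field_simp
    gcongr
    rw [h1, Real.norm_eq_abs, abs_div, abs_of_pos h0, one_div, inv_pow, div_eq_mul_inv]
    refine mul_le_of_le_one_left (by positivity) (abs_le.2 ⟨?_, ?_⟩)
    · linarith [Int.lt_floor_add_one (2 ^ k * s i)]
    · linarith [Int.floor_le (2 ^ k * s i)]
  simpa using Finset.sum_le_card_nsmul _ _ _ this

/-- The lattice points of level `k` in the cube `[-N, N]^κ`. -/
noncomputable def dyadicCube [DecidableEq κ] (N k : ℕ) : Finset (κ → ℤ) :=
  Fintype.piFinset fun _ => Finset.Icc (-(N * 2 ^ k : ℤ)) (N * 2 ^ k)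

/-- The offsets between neighbouring lattice points. -/
noncomputable def neighbourOffsets (κ : Type*) [Fintype κ] [DecidableEq κ] : Finset (κ → ℤ) :=
  Fintype.piFinset fun _ => Finset.Icc (-1) 1

variable [DecidableEq κ]

lemma dyadicFloor_mem {N : ℕ} {s : EuclideanSpace ℝ κ} (hs : ∀ i, |s i| ≤ N) (k : ℕ) :
    dyadicFloor k s ∈ dyadicCube N k := by
  simp only [dyadicCube, Fintype.mem_piFinset, Finset.mem_Icc, dyadicFloor]
  intro i
  have h := abs_le.1 (hs i)
  have h2 : (0 : ℝ) < 2 ^ k := by positivity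
  constructor
  · rw [Int.le_floor]
    push_cast
    nlinarith [h.1]
  · have : ((⌊2 ^ k * s i⌋ : ℤ) : ℝ) ≤ N * 2 ^ k := (Int.floor_le _).trans (by nlinarith [h.2])
    rw [← Int.cast_le (R := ℝ)]
    push_cast
    exact this

lemma two_mul_dyadicFloor_mem {N : ℕ} {s : EuclideanSpace ℝ κ} (hs : ∀ i, |s i| ≤ N) (k : ℕ) :
    (fun i => 2 * dyadicFloor k s i) ∈ dyadicCube N (k + 1) := by
  have h := dyadicFloor_mem hs k
  simp only [dyadicCube, Fintype.mem_piFinset, Finset.mem_Icc] at h ⊢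
  intro i
  have := h i
  rw [pow_succ]
  constructor <;> linarith [this.1, this.2]

/-- As `⌊2r⌋` is `2⌊r⌋` or `2⌊r⌋ + 1`, consecutive approximations of `s` are neighbours on the finer
lattice, so chaining costs one increment per level. -/
lemma dyadicFloor_succ_sub_mem (s : EuclideanSpace ℝ κ) (k : ℕ) :
    (dyadicFloor (k + 1) s - fun i => 2 * dyadicFloor k s i) ∈ neighbourOffsets κ := by
  simp only [neighbourOffsets, Fintype.mem_piFinset, Finset.mem_Icc, Pi.sub_apply, dyadicFloor]
  intro i
  have h1 := Int.floor_le (2 ^ k * s i)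
  have h2 := Int.lt_floor_add_one (2 ^ k * s i)
  have h3 : (2 : ℝ) ^ (k + 1) * s i = 2 * (2 ^ k * s i) := by ring
  rw [h3]
  generalize (2 : ℝ) ^ k * s i = r at *
  have h4 : 2 * ⌊r⌋ ≤ ⌊2 * r⌋ := by
    rw [Int.le_floor]; push_cast; linarith
  have h5 : ⌊2 * r⌋ < 2 * ⌊r⌋ + 2 := by
    rw [Int.floor_lt]; push_cast; linarith
  constructor <;> linarith

lemma dyadicFloor_sub_mem {s t : EuclideanSpace ℝ κ} {k : ℕ} (h : ‖s - t‖ ≤ (1 / 2) ^ k) :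
    dyadicFloor k s - dyadicFloor k t ∈ neighbourOffsets κ := by
  simp only [neighbourOffsets, Fintype.mem_piFinset, Finset.mem_Icc, Pi.sub_apply, dyadicFloor]
  intro i
  have h1 : |s i - t i| ≤ (1 / 2) ^ k := (PiLp.norm_apply_le (s - t) i).trans h
  have h2 : |2 ^ k * s i - 2 ^ k * t i| ≤ 1 := by
    rw [← mul_sub, abs_mul, abs_of_pos (by positivity : (0 : ℝ) < 2 ^ k)]
    calc (2 : ℝ) ^ k * |s i - t i| ≤ 2 ^ k * (1 / 2) ^ k := by gcongr
      _ = 1 := by rw [← mul_pow]; norm_num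
  generalize (2 : ℝ) ^ k * s i = a at *
  generalize (2 : ℝ) ^ k * t i = b at *
  rw [abs_le] at h2
  have h3 : ⌊a⌋ ≤ ⌊b⌋ + 1 := by
    rw [← Int.floor_add_one]; exact Int.floor_mono (by linarith)
  have h4 : ⌊b⌋ ≤ ⌊a⌋ + 1 := by
    rw [← Int.floor_add_one]; exact Int.floor_mono (by linarith)
  constructor <;> linarith

lemma norm_dyadicPoint_add_sub_le (k : ℕ) (z : κ → ℤ) {e : κ → ℤ} (he : e ∈ neighbourOffsets κ) :
    ‖dyadicPoint k (z + e) - dyadicPoint k z‖ ≤ √(Fintype.card κ) * (1 / 2) ^ k := by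
  rw [EuclideanSpace.norm_eq]
  refine Real.sqrt_le_iff.2 ⟨by positivity, ?_⟩
  rw [mul_pow, Real.sq_sqrt (by positivity)]
  have : ∀ i ∈ Finset.univ, ‖(dyadicPoint k (z + e) - dyadicPoint k z) i‖ ^ 2
      ≤ ((1 / 2 : ℝ) ^ k) ^ 2 := by
    intro i _
    have h0 : (0 : ℝ) < 2 ^ k := by positivity
    have h1 : (dyadicPoint k (z + e) - dyadicPoint k z) i = e i / 2 ^ k := by
      simp only [dyadicPoint, PiLp.sub_apply, Pi.add_apply]
      push_cast
      ring
    gcongr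
    rw [h1, Real.norm_eq_abs, abs_div, abs_of_pos h0, one_div, inv_pow, div_eq_mul_inv]
    simp only [neighbourOffsets, Fintype.mem_piFinset, Finset.mem_Icc] at he
    refine mul_le_of_le_one_left (by positivity) (abs_le.2 ⟨?_, ?_⟩)
    · exact_mod_cast (he i).1
    · exact_mod_cast (he i).2
  simpa using Finset.sum_le_card_nsmul _ _ _ this

/-! ### Chaining: from dyadic increments to Hölder paths. -/

/-- The increments of `y` between neighbouring dyadic points of level `k` in `[-N, N]^κ` are at
most `A 2^{-αk}`. -/
def DyadicHolder (α A : ℝ) (N : ℕ) (y : EuclideanSpace ℝ κ → ℝ) : Prop :=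
  ∀ k, ∀ z ∈ dyadicCube N k, ∀ e ∈ neighbourOffsets κ,
    |y (dyadicPoint k (z + e)) - y (dyadicPoint k z)| ≤ A * ((1 / 2 : ℝ) ^ α) ^ k

lemma half_rpow_lt_one {α : ℝ} (hα : 0 < α) : (1 / 2 : ℝ) ^ α < 1 :=
  Real.rpow_lt_one (by norm_num) (by norm_num) hα

namespace DyadicHolder

variable {α A : ℝ} {N : ℕ} {y : EuclideanSpace ℝ κ → ℝ} {s t : EuclideanSpace ℝ κ}

lemma dist_succ_le (h : DyadicHolder α A N y) (hα : 0 < α) (hA : 0 ≤ A)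
    (hs : ∀ i, |s i| ≤ N) (k : ℕ) :
    dist (y (dyadicPoint k (dyadicFloor k s))) (y (dyadicPoint (k + 1) (dyadicFloor (k + 1) s)))
      ≤ A * ((1 / 2 : ℝ) ^ α) ^ k := by
  have h1 := h (k + 1) _ (two_mul_dyadicFloor_mem hs k) _ (dyadicFloor_succ_sub_mem s k)
  rw [dyadicPoint_two_mul, add_sub_cancel] at h1
  rw [dist_comm, Real.dist_eq]
  refine h1.trans ?_
  gcongr A * ?_
  exact pow_le_pow_of_le_one (by positivity) (half_rpow_lt_one hα).le (Nat.le_succ k)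

lemma tendsto (h : DyadicHolder α A N y) (hα : 0 < α) (hA : 0 ≤ A) (hs : ∀ i, |s i| ≤ N) :
    Tendsto (fun k => y (dyadicPoint k (dyadicFloor k s))) atTop (𝓝 (dyadicLimit y s)) := by
  obtain ⟨l, hl⟩ := cauchySeq_tendsto_of_complete
    (cauchySeq_of_le_geometric _ A (half_rpow_lt_one hα) (h.dist_succ_le hα hA hs))
  rwa [dyadicLimit, hl.limsup_eq]

lemma dist_dyadicLimit_le (h : DyadicHolder α A N y) (hα : 0 < α) (hA : 0 ≤ A)
    (hs : ∀ i, |s i| ≤ N) (k : ℕ) :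
    dist (y (dyadicPoint k (dyadicFloor k s))) (dyadicLimit y s)
      ≤ A * ((1 / 2 : ℝ) ^ α) ^ k / (1 - (1 / 2 : ℝ) ^ α) :=
  dist_le_of_le_geometric_of_tendsto _ A (half_rpow_lt_one hα) (h.dist_succ_le hα hA hs)
    (h.tendsto hα hA hs) k

lemma dist_dyadicLimit_le_rpow (h : DyadicHolder α A N y) (hα : 0 < α) (hA : 0 ≤ A)
    (hs : ∀ i, |s i| ≤ N) (ht : ∀ i, |t i| ≤ N) (hst : dist s t ≤ 1) :
    dist (dyadicLimit y s) (dyadicLimit y t)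
      ≤ A * (1 + 2 / (1 - (1 / 2 : ℝ) ^ α)) * 2 ^ α * dist s t ^ α := by
  rcases eq_or_ne s t with rfl | hne
  · simp [Real.zero_rpow hα.ne']
  -- The level is chosen with `2^{-(k+1)} < dist s t ≤ 2^{-k}`: the upper bound makes the level-`k`
  -- approximations neighbours, and the lower one turns `2^{-αk}` into `dist s t ^ α` at the cost of
  -- `2 ^ α`. The path runs from `s` to `t` through these two approximations.
  obtain ⟨k, hk1, hk2⟩ := exists_nat_pow_near_of_lt_one (dist_pos.2 hne) hst
    (by norm_num : (0 : ℝ) < 1 / 2) (by norm_num)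
  have h1 := h k _ (dyadicFloor_mem ht k) _ (dyadicFloor_sub_mem (by rwa [← dist_eq_norm]))
  rw [add_sub_cancel, ← Real.dist_eq] at h1
  have h2 := h.dist_dyadicLimit_le hα hA hs k
  have h3 := h.dist_dyadicLimit_le hα hA ht k
  have h4 : ((1 / 2 : ℝ) ^ α) ^ k ≤ 2 ^ α * dist s t ^ α := by
    rw [← Real.rpow_natCast, ← Real.rpow_mul (by norm_num), mul_comm α,
      Real.rpow_mul (by norm_num), Real.rpow_natCast,
      ← Real.mul_rpow (by norm_num) dist_nonneg]
    refine Real.rpow_le_rpow (by positivity) ?_ hα.le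
    rw [pow_succ] at hk1
    linarith
  have h5 : 0 < 1 - (1 / 2 : ℝ) ^ α := sub_pos.2 (half_rpow_lt_one hα)
  have h6 := dist_triangle4 (dyadicLimit y s) (y (dyadicPoint k (dyadicFloor k s)))
    (y (dyadicPoint k (dyadicFloor k t))) (dyadicLimit y t)
  rw [dist_comm] at h2
  calc dist (dyadicLimit y s) (dyadicLimit y t)
      ≤ A * ((1 / 2 : ℝ) ^ α) ^ k + (A * ((1 / 2 : ℝ) ^ α) ^ k / (1 - (1 / 2 : ℝ) ^ α)
        + A * ((1 / 2 : ℝ) ^ α) ^ k / (1 - (1 / 2 : ℝ) ^ α)) := by linarith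
    _ = A * (1 + 2 / (1 - (1 / 2 : ℝ) ^ α)) * ((1 / 2 : ℝ) ^ α) ^ k := by ring
    _ ≤ A * (1 + 2 / (1 - (1 / 2 : ℝ) ^ α)) * (2 ^ α * dist s t ^ α) := by gcongr
    _ = _ := by ring

lemma continuousOn (h : DyadicHolder α A N y) (hα : 0 < α) (hA : 0 ≤ A) :
    ContinuousOn (dyadicLimit y) {s | ∀ i, |s i| ≤ N} := by
  intro s hs
  rw [ContinuousWithinAt, tendsto_iff_dist_tendsto_zero]
  set C := A * (1 + 2 / (1 - (1 / 2 : ℝ) ^ α)) * 2 ^ α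
  have hlim : Tendsto (fun t => C * dist t s ^ α) (𝓝[{s | ∀ i, |s i| ≤ N}] s) (𝓝 0) := by
    have hc : Continuous fun t : EuclideanSpace ℝ κ => C * dist t s ^ α :=
      continuous_const.mul ((Real.continuous_rpow_const hα.le).comp (by fun_prop))
    have := hc.tendsto s
    simp only [dist_self, Real.zero_rpow hα.ne', mul_zero] at this
    exact this.mono_left nhdsWithin_le_nhds
  refine squeeze_zero' (Eventually.of_forall fun _ => dist_nonneg) ?_ hlim
  have h1 : ∀ᶠ t in 𝓝[{s | ∀ i, |s i| ≤ N}] s, dist t s ≤ 1 :=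
    nhdsWithin_le_nhds (Metric.closedBall_mem_nhds s one_pos)
  filter_upwards [h1, self_mem_nhdsWithin] with t ht1 ht
  exact h.dist_dyadicLimit_le_rpow hα hA ht hs ht1

lemma exists_holderOnWith {α : ℝ≥0} (h : DyadicHolder α A N y) (hα : 0 < α) (hA : 0 ≤ A)
    {S : Set (EuclideanSpace ℝ κ)} (hS : IsCompact S) (hSN : ∀ s ∈ S, ∀ i, |s i| ≤ N) :
    ∃ C : ℝ≥0, HolderOnWith C α (dyadicLimit y) S := by
  have hα' : (0 : ℝ) < α := hα
  have hc : ContinuousOn (dyadicLimit y) S := (h.continuousOn hα' hA).mono hSN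
  obtain ⟨B, hB⟩ := hS.exists_bound_of_continuousOn hc
  have h5 : 0 < 1 - (1 / 2 : ℝ) ^ (α : ℝ) := sub_pos.2 (half_rpow_lt_one hα')
  set C := A * (1 + 2 / (1 - (1 / 2 : ℝ) ^ (α : ℝ))) * 2 ^ (α : ℝ) with hC
  have hC0 : 0 ≤ C := by positivity
  refine ⟨(C + 2 * |B|).toNNReal, fun s hs t ht => ?_⟩
  have hd : dist (dyadicLimit y s) (dyadicLimit y t) ≤ (C + 2 * |B|) * dist s t ^ (α : ℝ) := by
    rcases le_total (dist s t) 1 with h1 | h1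
    · refine (h.dist_dyadicLimit_le_rpow hα' hA (hSN s hs) (hSN t ht) h1).trans ?_
      rw [← hC]
      gcongr
      linarith [abs_nonneg B]
    -- Far apart points need no chaining: the bound `B` on the compact set suffices because `dist s
    -- t ^ α ≥ 1`.
    · have h2 : 1 ≤ dist s t ^ (α : ℝ) := Real.one_le_rpow h1 hα'.le
      have h3 : dist (dyadicLimit y s) (dyadicLimit y t) ≤ 2 * |B| := by
        refine (dist_le_norm_add_norm _ _).trans ?_
        linarith [hB s hs, hB t ht, le_abs_self B]
      have h6 : 0 ≤ C + 2 * |B| := by positivity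
      nlinarith [abs_nonneg B]
  rw [edist_dist, edist_dist, ENNReal.ofReal_rpow_of_nonneg dist_nonneg hα'.le,
    ← ENNReal.ofReal_coe_nnreal, Real.coe_toNNReal _ (by positivity),
    ← ENNReal.ofReal_mul (by positivity)]
  exact ENNReal.ofReal_le_ofReal hd

end DyadicHolder

/-! ### From moment bounds to dyadic increments and a modification. -/

lemma card_dyadicCube_le (N k : ℕ) :
    ((dyadicCube N k : Finset (κ → ℤ)).card : ℝ)
      ≤ (2 * N + 1) ^ Fintype.card κ * (2 ^ Fintype.card κ) ^ k := by
  have h : (dyadicCube N k : Finset (κ → ℤ)).card = (2 * N * 2 ^ k + 1) ^ Fintype.card κ := by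
    simp only [dyadicCube, Fintype.card_piFinset, Int.card_Icc, Finset.prod_const,
      Finset.card_univ]
    congr 1
    zify
    rw [Int.toNat_of_nonneg (by
      have : (0 : ℤ) ≤ N * 2 ^ k := by positivity
      linarith)]
    ring
  rw [h]
  push_cast
  rw [pow_right_comm, ← mul_pow]
  have h1 : (1 : ℝ) ≤ 2 ^ k := one_le_pow₀ (by norm_num)
  gcongr
  linarith

variable {Ω : Type*} {mΩ : MeasurableSpace Ω} {P : Measure Ω} {Y : EuclideanSpace ℝ κ → Ω → ℝ}

/-- The sum `F` of all `p`-th powers of dyadic increments, weighted by `2^{αpk}` at level `k`, has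
finite expectation. It is therefore almost surely finite and dominates each of its terms. -/
lemma ae_exists_dyadicHolder (hY : ∀ s, Measurable (Y s)) {p : ℕ} (hp : p ≠ 0) {q α K : ℝ}
    (hq0 : 0 ≤ q) (hK : 0 ≤ K)
    (hmom : ∀ s t, ∫⁻ ω, ‖Y s ω - Y t ω‖ₑ ^ p ∂P ≤ ENNReal.ofReal (K * ‖s - t‖ ^ q))
    (hq : Fintype.card κ + α * p < q) (N : ℕ) :
    ∀ᵐ ω ∂P, ∃ A, 0 ≤ A ∧ DyadicHolder α A N (fun s => Y s ω) := by
  set d := Fintype.card κ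
  set w : ℝ := 2 ^ α with hw
  have hw0 : 0 < w := by positivity
  have hw1 : (1 / 2 : ℝ) ^ α = w⁻¹ := by
    rw [one_div, Real.inv_rpow (by norm_num)]
  set D : ℕ → (κ → ℤ) → (κ → ℤ) → Ω → ℝ :=
    fun k z e ω => Y (dyadicPoint k (z + e)) ω - Y (dyadicPoint k z) ω with hD
  set F : Ω → ℝ≥0∞ := fun ω => ∑' k, ∑ z ∈ dyadicCube N k, ∑ e ∈ neighbourOffsets κ,
    ENNReal.ofReal ((w ^ p) ^ k) * ‖D k z e ω‖ₑ ^ p with hF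
  have hDm : ∀ k z e, Measurable (D k z e) := fun k z e => (hY _).sub (hY _)
  have hterm : ∀ k z e, Measurable fun ω => ENNReal.ofReal ((w ^ p) ^ k) * ‖D k z e ω‖ₑ ^ p :=
    fun k z e => ((hDm k z e).enorm.pow_const p).const_mul _
  have hFm : Measurable F := by
    refine Measurable.tsum fun k => Finset.measurable_fun_sum _ fun z _ =>
      Finset.measurable_fun_sum _ fun e _ => hterm k z e
  -- The geometric ratio between levels: `2 ^ d` counts lattice points, `w ^ p` is the weight,
  -- `(1/2) ^ q` the decay of the moments. It equals `2 ^ (d + αp - q) < 1`.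
  set θ : ℝ := 2 ^ d * w ^ p * (1 / 2 : ℝ) ^ q with hθ
  have hθ0 : 0 ≤ θ := by positivity
  have hθ1 : θ < 1 := by
    have : θ = (2 : ℝ) ^ (d + α * p - q) := by
      rw [hθ, hw, one_div, Real.inv_rpow (by norm_num), ← Real.rpow_mul_natCast (by norm_num),
        ← Real.rpow_neg (by norm_num), ← Real.rpow_natCast 2 d, ← Real.rpow_add (by norm_num),
        ← Real.rpow_add (by norm_num)]
      congr 1
    rw [this]
    exact Real.rpow_lt_one_of_one_lt_of_neg (by norm_num) (by linarith)
  set c : ℝ := (neighbourOffsets κ).card * ((2 * N + 1) ^ d * (K * √d ^ q)) with hc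
  have hF_int : ∫⁻ ω, F ω ∂P ≠ ⊤ := by
    have hle : ∫⁻ ω, F ω ∂P ≤ ∑' k : ℕ, ENNReal.ofReal (c * θ ^ k) := by
      rw [hF, lintegral_tsum fun k => (Finset.measurable_fun_sum _ fun z _ =>
        Finset.measurable_fun_sum _ fun e _ => hterm k z e).aemeasurable]
      refine ENNReal.tsum_le_tsum fun k => ?_
      rw [lintegral_finsetSum _ fun z _ => Finset.measurable_fun_sum _ fun e _ => hterm k z e]
      have h1 : ∀ z ∈ dyadicCube N k,
          ∫⁻ ω, ∑ e ∈ neighbourOffsets κ, ENNReal.ofReal ((w ^ p) ^ k) * ‖D k z e ω‖ₑ ^ p ∂P ≤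
          (neighbourOffsets κ).card •
            ENNReal.ofReal ((w ^ p) ^ k * (K * (√d * (1 / 2) ^ k) ^ q)) := by
        intro z _
        rw [lintegral_finsetSum _ fun e _ => hterm k z e]
        refine Finset.sum_le_card_nsmul _ _ _ fun e he => ?_
        rw [lintegral_const_mul _ ((hDm k z e).enorm.pow_const p),
          ENNReal.ofReal_mul (by positivity)]
        gcongr
        refine (hmom _ _).trans (ENNReal.ofReal_le_ofReal ?_)
        gcongr
        exact norm_dyadicPoint_add_sub_le k z he
      refine (Finset.sum_le_card_nsmul _ _ _ h1).trans ?_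
      rw [smul_smul, nsmul_eq_mul, ← ENNReal.ofReal_natCast, ← ENNReal.ofReal_mul (by positivity)]
      refine ENNReal.ofReal_le_ofReal ?_
      have h2 : (√d * (1 / 2) ^ k) ^ q = √d ^ q * ((1 / 2 : ℝ) ^ q) ^ k := by
        rw [Real.mul_rpow (by positivity) (by positivity), ← Real.rpow_natCast, ← Real.rpow_mul
          (by norm_num), mul_comm (k : ℝ), Real.rpow_mul (by norm_num), Real.rpow_natCast]
      rw [h2, hc, hθ]
      push_cast
      calc _ ≤ ((2 * N + 1) ^ d * (2 ^ d) ^ k) * ((neighbourOffsets κ).card : ℝ)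
            * ((w ^ p) ^ k * (K * (√d ^ q * ((1 / 2 : ℝ) ^ q) ^ k))) := by
            gcongr
            exact card_dyadicCube_le N k
        _ = _ := by rw [mul_pow, mul_pow]; ring
    refine ne_top_of_le_ne_top ?_ hle
    have hs : Summable fun k : ℕ => c * θ ^ k := (summable_geometric_of_lt_one hθ0 hθ1).mul_left c
    exact hs.tsum_ofReal_ne_top
  filter_upwards [ae_lt_top hFm hF_int] with ω hω
  -- The maximum with `1` avoids a `p`-th root: a number at least `1` is at most its own `p`-th
  -- power.
  refine ⟨max 1 (F ω).toReal, by positivity, fun k z hz e he => ?_⟩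
  have h1 : ENNReal.ofReal ((w ^ p) ^ k) * ‖D k z e ω‖ₑ ^ p ≤ F ω :=
    (Finset.single_le_sum (f := fun e => ENNReal.ofReal ((w ^ p) ^ k) * ‖D k z e ω‖ₑ ^ p)
      (fun _ _ => zero_le) he).trans <|
    (Finset.single_le_sum (f := fun z => ∑ e ∈ neighbourOffsets κ,
      ENNReal.ofReal ((w ^ p) ^ k) * ‖D k z e ω‖ₑ ^ p) (fun _ _ => zero_le) hz).trans <|
    ENNReal.le_tsum (f := fun k => ∑ z ∈ dyadicCube N k, ∑ e ∈ neighbourOffsets κ,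
      ENNReal.ofReal ((w ^ p) ^ k) * ‖D k z e ω‖ₑ ^ p) k
  rw [← ofReal_norm, ← ENNReal.ofReal_pow (norm_nonneg _),
    ← ENNReal.ofReal_mul (by positivity), ENNReal.ofReal_le_iff_le_toReal hω.ne, pow_right_comm,
    ← mul_pow] at h1
  have h2 : (w ^ k * ‖D k z e ω‖) ^ p ≤ (max 1 (F ω).toReal) ^ p :=
    h1.trans ((le_max_right _ _).trans (le_self_pow₀ (le_max_left _ _) hp))
  have h3 := (pow_le_pow_iff_left₀ (by positivity) (by positivity) hp).1 h2
  rw [hw1, inv_pow, ← div_eq_mul_inv, le_div_iff₀ (by positivity), mul_comm]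
  exact h3

/-- If the moments of the increments of `Y` are bounded by powers of the distance, then
`dyadicLimit` of the paths of `Y` is a modification of `Y`. -/
lemma dyadicLimit_ae_eq (hY : ∀ s, Measurable (Y s)) {p : ℕ} (hp : p ≠ 0) {q α K : ℝ}
    (hα : 0 < α) (hq0 : 0 < q) (hK : 0 ≤ K)
    (hmom : ∀ s t, ∫⁻ ω, ‖Y s ω - Y t ω‖ₑ ^ p ∂P ≤ ENNReal.ofReal (K * ‖s - t‖ ^ q))
    (hq : Fintype.card κ + α * p < q) (s : EuclideanSpace ℝ κ) :
    (fun ω => dyadicLimit (fun s => Y s ω) s) =ᵐ[P] Y s := by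
  have hzero : Tendsto (fun k : ℕ => √(Fintype.card κ) * (1 / 2 : ℝ) ^ k) atTop (𝓝 0) := by
    simpa using (tendsto_pow_atTop_nhds_zero_of_lt_one (by norm_num : (0 : ℝ) ≤ 1 / 2)
      (by norm_num)).const_mul (√(Fintype.card κ))
  have hdist : Tendsto (fun k => ‖dyadicPoint k (dyadicFloor k s) - s‖) atTop (𝓝 0) :=
    squeeze_zero (fun _ => norm_nonneg _) (fun k => norm_dyadicPoint_floor_sub_le k s) hzero
  have hp0 : (0 : ℝ) < p := by exact_mod_cast Nat.pos_of_ne_zero hp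
  have hLp : Tendsto (fun k => eLpNorm (Y (dyadicPoint k (dyadicFloor k s)) - Y s) p P)
      atTop (𝓝 0) := by
    have h1 : Tendsto (fun k => (ENNReal.ofReal
        (K * ‖dyadicPoint k (dyadicFloor k s) - s‖ ^ q)) ^ (1 / (p : ℝ))) atTop (𝓝 0) := by
      have h2 : Tendsto (fun r : ℝ => (ENNReal.ofReal (K * r ^ q)) ^ (1 / (p : ℝ))) (𝓝 0)
          (𝓝 0) := by
        have hc : Continuous fun r : ℝ => (ENNReal.ofReal (K * r ^ q)) ^ (1 / (p : ℝ)) := by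
          refine ENNReal.continuous_rpow_const.comp (ENNReal.continuous_ofReal.comp ?_)
          exact continuous_const.mul (Real.continuous_rpow_const hq0.le)
        simpa [Real.zero_rpow hq0.ne', hp0] using hc.tendsto 0
      exact h2.comp hdist
    refine tendsto_of_tendsto_of_tendsto_of_le_of_le tendsto_const_nhds h1 (fun _ => zero_le)
      fun k => ?_
    rw [eLpNorm_eq_lintegral_rpow_enorm_toReal (by exact_mod_cast hp) (by simp)]
    simp only [ENNReal.toReal_natCast]
    gcongr
    refine le_trans (le_of_eq ?_) (hmom _ _)
    simp
  -- Convergence in `Lᵖ` yields almost sure convergence to `Y s` along a subsequence. The full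
  -- dyadic sequence converges to `dyadicLimit`, so the two limits agree.
  obtain ⟨ns, hns, hlim⟩ := (tendstoInMeasure_of_tendsto_eLpNorm (by exact_mod_cast hp)
    (fun k => (hY _).aestronglyMeasurable) (hY s).aestronglyMeasurable hLp).exists_seq_tendsto_ae
  obtain ⟨N, hN⟩ := exists_nat_ge ‖s‖
  filter_upwards [hlim, ae_exists_dyadicHolder hY hp hq0.le hK hmom hq N] with ω hω ⟨A, hA, hH⟩
  exact tendsto_nhds_unique
    ((hH.tendsto hα hA fun i => (PiLp.norm_apply_le s i).trans hN).comp hns.tendsto_atTop) hω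

lemma ae_exists_holderOnWith (hY : ∀ s, Measurable (Y s)) {p : ℕ} (hp : p ≠ 0) {q K : ℝ}
    {α : ℝ≥0} (hα : 0 < α) (hq0 : 0 < q) (hK : 0 ≤ K)
    (hmom : ∀ s t, ∫⁻ ω, ‖Y s ω - Y t ω‖ₑ ^ p ∂P ≤ ENNReal.ofReal (K * ‖s - t‖ ^ q))
    (hq : Fintype.card κ + α * p < q) :
    ∀ᵐ ω ∂P, ∀ S : Set (EuclideanSpace ℝ κ), IsCompact S →
      ∃ C : ℝ≥0, HolderOnWith C α (fun s => dyadicLimit (fun s => Y s ω) s) S := by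
  -- One null set serves all compact sets, since each lies in some cube `[-N, N]^κ` with `N` a
  -- natural number.
  filter_upwards [ae_all_iff.2 (ae_exists_dyadicHolder hY hp hq0.le hK hmom hq)] with ω hω S hS
  obtain ⟨R, hR⟩ := hS.isBounded.exists_norm_le
  obtain ⟨N, hN⟩ := exists_nat_ge R
  obtain ⟨A, hA, hH⟩ := hω N
  exact hH.exists_holderOnWith hα hA hS fun s hs i =>
    (PiLp.norm_apply_le s i).trans ((hR s hs).trans hN)

end KolmogorovChentsov

/-! ### Gaussian moments of Paley–Wiener integrals, and the reduction to bounds in `H⁻²` -/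

namespace GFF4

section Moments

variable {K Θ : Type*} [NormedAddCommGroup K] [InnerProductSpace ℝ K] [CompleteSpace K]
  [NormedAddCommGroup Θ] [NormedSpace ℝ Θ] [MeasurableSpace Θ] [BorelSpace Θ] {ι : K →L[ℝ] Θ}
  {W : Measure Θ}

namespace IsAbstractWienerSpace

lemma eLpNorm_dual (hW : IsAbstractWienerSpace ι W) (x' : StrongDual ℝ Θ) (p : ℝ≥0∞) :
    eLpNorm (fun θ => x' θ) p W = ‖dualRep ι x'‖ₑ * eLpNorm id p (gaussianReal 0 1) := by
  have h1 : eLpNorm (fun θ => x' θ) p W = eLpNorm id p (W.map x') :=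
    (eLpNorm_map_measure aestronglyMeasurable_id x'.continuous.measurable.aemeasurable).symm
  have h2 : gaussianReal 0 (‖dualRep ι x'‖₊ ^ 2)
      = (gaussianReal 0 1).map fun y => ‖dualRep ι x'‖ * y := by
    rw [gaussianReal_map_const_mul]
    congr 1
    · simp
    · ext
      simp
  rw [h1, hW.map_eq, h2, eLpNorm_map_measure aestronglyMeasurable_id (by fun_prop)]
  have h3 : (id ∘ fun y => ‖dualRep ι x'‖ * y) = ‖dualRep ι x'‖ • (id : ℝ → ℝ) := by
    ext y
    simp
  rw [h3, eLpNorm_const_smul, enorm_norm]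

/-- Elements `dualRep ι x'` approximate `h`. Along a subsequence their images converge almost
surely, and Fatou's lemma passes the Gaussian `p`-norm to the limit. -/
lemma eLpNorm_paleyWiener_le (hW : IsAbstractWienerSpace ι W) (h : K) (p : ℝ≥0) :
    eLpNorm (hW.paleyWiener h) p W ≤ ‖h‖ₑ * eLpNorm id p (gaussianReal 0 1) := by
  have hdense := denseRange_dualRep hW.injective
  obtain ⟨u, hu, hlim⟩ := mem_closure_iff_seq_limit.1 (hdense h)
  choose x' hx' using hu
  have h1 : Tendsto (fun n => hW.paleyWiener (u n)) atTop (𝓝 (hW.paleyWiener h)) :=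
    (hW.paleyWiener.continuous.tendsto h).comp hlim
  obtain ⟨ns, hns, hae⟩ := (tendstoInMeasure_of_tendsto_Lp h1).exists_seq_tendsto_ae
  refine (Lp.eLpNorm_lim_le_liminf_eLpNorm (fun n => (Lp.aestronglyMeasurable _)) _ hae).trans ?_
  have h2 : ∀ n, eLpNorm (hW.paleyWiener (u (ns n))) p W
      = ‖u (ns n)‖ₑ * eLpNorm id p (gaussianReal 0 1) := fun n => by
    rw [← hx', eLpNorm_congr_ae (hW.paleyWiener_dualRep _), hW.eLpNorm_dual]
  simp only [h2]
  refine (ENNReal.Tendsto.mul_const ?_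
    (Or.inr (memLp_id_gaussianReal p).eLpNorm_ne_top)).liminf_eq.le
  exact (hlim.comp hns.tendsto_atTop).enorm

end IsAbstractWienerSpace

end Moments

/-! ### From bounds in `H⁻²` to a Hölder modification. -/

lemma norm_riesz_sub_le {μ ν : 𝓢(R4, ℝ) →L[ℝ] ℝ} {C : ℝ}
    (hμ : ∃ C, ∀ f, ‖μ f‖ ≤ C * ‖toH f‖) (hν : ∃ C, ∀ f, ‖ν f‖ ≤ C * ‖toH f‖)
    (hC : 0 ≤ C) (h : ∀ f, ‖μ f - ν f‖ ≤ C * ‖toH f‖) : ‖riesz μ - riesz ν‖ ≤ C := by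
  set v := riesz μ - riesz ν with hv
  have h1 : ∀ z : H, ‖inner ℝ z v‖ ≤ C * ‖z‖ := fun z => by
    refine denseRange_toH.induction_on (p := fun z => ‖inner ℝ z v‖ ≤ C * ‖z‖) z ?_ fun f => ?_
    · exact isClosed_le (by fun_prop) (by fun_prop)
    · rw [hv, inner_sub_right, inner_toH_riesz hμ, inner_toH_riesz hν]
      exact h f
  -- Testing the difference of representers against itself gives `‖v‖² ≤ C ‖v‖`.
  have h2 := h1 v
  rw [real_inner_self_eq_norm_sq, Real.norm_of_nonneg (by positivity), pow_two] at h2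
  rcases (norm_nonneg v).eq_or_lt with h0 | h0
  · rwa [← h0]
  · exact le_of_mul_le_mul_right h2 h0


lemma exists_holder_modification {Θ : Type*} [NormedAddCommGroup Θ] [NormedSpace ℝ Θ]
    [MeasurableSpace Θ] [BorelSpace Θ] {ι : H →L[ℝ] Θ} {W : Measure Θ}
    (hW : IsAbstractWienerSpace ι W) (h : R4 → H) {C : ℝ} (hC : 0 ≤ C)
    (hh : ∀ x y, ‖h x - h y‖ ≤ C * √‖x - y‖) :
    ∃ X : R4 → Θ → ℝ,
      (∀ x, Measurable (X x) ∧ X x =ᵐ[W] hW.paleyWiener (h x)) ∧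
      ∀ α : ℝ≥0, 0 < α → α < 1 / 2 →
        ∀ᵐ θ ∂W, ∀ S : Set R4, IsCompact S →
          ∃ C : ℝ≥0, HolderOnWith C α (fun x => X x θ) S := by
  set Y : R4 → Θ → ℝ := fun x => hW.paleyWiener (h x) with hY
  have hYm : ∀ x, Measurable (Y x) := fun x => (Lp.stronglyMeasurable _).measurable
  have hmom : ∀ p : ℕ, p ≠ 0 → ∃ K : ℝ, 0 ≤ K ∧ ∀ s t,
      ∫⁻ θ, ‖Y s θ - Y t θ‖ₑ ^ p ∂W ≤ ENNReal.ofReal (K * ‖s - t‖ ^ ((p : ℝ) / 2)) := by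
    intro p hp
    have hfin : eLpNorm id (p : ℝ≥0) (gaussianReal 0 1) ≠ ⊤ :=
      (memLp_id_gaussianReal (p : ℝ≥0)).eLpNorm_ne_top
    set m := (eLpNorm id (p : ℝ≥0) (gaussianReal 0 1)).toReal with hm
    refine ⟨(C * m) ^ p, by positivity, fun s t => ?_⟩
    have h1 : ∫⁻ θ, ‖Y s θ - Y t θ‖ₑ ^ p ∂W
        = eLpNorm (hW.paleyWiener (h s - h t)) (p : ℝ≥0) W ^ p := by
      have h2 := eLpNorm_nnreal_pow_eq_lintegral (μ := W) (f := hW.paleyWiener (h s - h t))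
        (p := (p : ℝ≥0)) (by exact_mod_cast hp)
      simp only [NNReal.coe_natCast, ENNReal.rpow_natCast] at h2
      rw [h2]
      refine lintegral_congr_ae ?_
      rw [map_sub]
      filter_upwards [Lp.coeFn_sub (hW.paleyWiener (h s)) (hW.paleyWiener (h t))] with θ hθ
      rw [hθ]
      rfl
    rw [h1]
    have h3 : eLpNorm (hW.paleyWiener (h s - h t)) (p : ℝ≥0) W
        ≤ ENNReal.ofReal (C * √‖s - t‖ * m) := by
      refine (hW.eLpNorm_paleyWiener_le _ _).trans ?_
      rw [ENNReal.ofReal_mul (by positivity), hm, ENNReal.ofReal_toReal hfin, ← ofReal_norm]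
      gcongr
      exact hh s t
    refine (pow_le_pow_left' h3 p).trans ?_
    rw [← ENNReal.ofReal_pow (by positivity)]
    refine ENNReal.ofReal_le_ofReal (le_of_eq ?_)
    have h4 : ‖s - t‖ ^ ((p : ℝ) / 2) = √‖s - t‖ ^ p := by
      rw [Real.sqrt_eq_rpow, ← Real.rpow_mul_natCast (norm_nonneg _)]
      congr 1
      ring
    rw [h4]
    ring
  -- This modification depends on neither `p` nor `α`, so it can be fixed before the exponent is
  -- chosen.
  refine ⟨fun x θ => KolmogorovChentsov.dyadicLimit (fun s => Y s θ) x, fun x => ⟨?_, ?_⟩, ?_⟩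
  · exact KolmogorovChentsov.measurable_dyadicLimit hYm x
  -- Being a modification needs only one admissible pair: with `α = 1/4` the condition `4 + p/4 <
  -- p/2` means `p > 16`.
  · obtain ⟨K, hK, hK2⟩ := hmom 17 (by norm_num)
    refine KolmogorovChentsov.dyadicLimit_ae_eq hYm (p := 17) (by norm_num) (α := 1 / 4)
      (by norm_num) (by norm_num) hK hK2 ?_ x
    rw [Fintype.card_fin]
    norm_num
  · intro α hα hα2
    have hα3 : (α : ℝ) < 1 / 2 := by exact_mod_cast hα2
    -- This is exactly `4 + α p < p / 2`.
    obtain ⟨p, hp⟩ := exists_nat_gt (4 / (1 / 2 - (α : ℝ)))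
    rw [div_lt_iff₀ (by linarith)] at hp
    have hp0 : p ≠ 0 := by
      rintro rfl
      norm_num at hp
    obtain ⟨K, hK, hK2⟩ := hmom p hp0
    refine KolmogorovChentsov.ae_exists_holderOnWith hYm hp0 hα ?_ hK hK2 ?_
    · have : (0 : ℝ) < p := by exact_mod_cast Nat.pos_of_ne_zero hp0
      positivity
    · rw [Fintype.card_fin]
      push_cast
      linarith

lemma continuous_of_norm_sub_le {h : R4 → H} {C : ℝ}
    (hh : ∀ x y, ‖h x - h y‖ ≤ C * √‖x - y‖) : Continuous h := by
  rw [continuous_iff_continuousAt]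
  intro x
  rw [ContinuousAt, tendsto_iff_norm_sub_tendsto_zero]
  have hc : Continuous fun y : R4 => C * √‖y - x‖ := by fun_prop
  refine squeeze_zero (fun _ => norm_nonneg _) (fun y => hh y x) ?_
  simpa using hc.tendsto x

end GFF4

noncomputable section

/-! ### `L²` bounds by the norm of `H`, and convolution with kernels supported in a ball -/

namespace GFF4

open scoped LineDeriv

/-- The `i`-th partial derivative of a Schwartz function. -/
def partialDeriv (i : Fin 4) (f : 𝓢(R4, ℝ)) : 𝓢(R4, ℝ) :=
  ∂_{EuclideanSpace.basisFun (Fin 4) ℝ i} f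

lemma partialDeriv_apply (i : Fin 4) (f : 𝓢(R4, ℝ)) (x : R4) :
    partialDeriv i f x = fderiv ℝ f x (EuclideanSpace.basisFun (Fin 4) ℝ i) :=
  SchwartzMap.lineDerivOp_apply_eq_fderiv _ f x

lemma laplacian_eq_sum_partialDeriv (f : 𝓢(R4, ℝ)) :
    Δ f = ∑ i, partialDeriv i (partialDeriv i f) :=
  SchwartzMap.laplacian_eq_sum (EuclideanSpace.basisFun (Fin 4) ℝ) f

lemma fderiv_apply_eq_sum (f : 𝓢(R4, ℝ)) (x v : R4) :
    fderiv ℝ f x v = ∑ i, v i * partialDeriv i f x := by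
  conv_lhs => rw [← (EuclideanSpace.basisFun (Fin 4) ℝ).sum_repr v]
  simp only [map_sum, map_smul, smul_eq_mul, partialDeriv_apply, EuclideanSpace.basisFun_repr]

lemma integral_mul_laplacian (f : 𝓢(R4, ℝ)) :
    ∫ x, f x * Δ f x = -∑ i, ∫ x, partialDeriv i f x ^ 2 := by
  have h : ∀ x, f x * Δ f x = ∑ i, f x * partialDeriv i (partialDeriv i f) x := fun x => by
    rw [laplacian_eq_sum_partialDeriv, _root_.sum_apply, Finset.mul_sum]
  simp only [h]
  rw [integral_finsetSum _ fun i _ => integrable_mul _ _, ← Finset.sum_neg_distrib]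
  refine Finset.sum_congr rfl fun i _ => ?_
  simp only [pow_two]
  exact SchwartzMap.integral_mul_lineDerivOp_right_eq_neg_left f (partialDeriv i f) _

/-- In the square of `f - Δ f` the cross term `-2 ∫ f Δ f` becomes `+2 ∫ |∇f|²` after integration by
parts. All terms are nonnegative, so each is controlled by the norm of `H`. -/
lemma norm_toH_sq (f : 𝓢(R4, ℝ)) :
    ‖toH f‖ ^ 2 = (∫ x, f x ^ 2) + 2 * (∑ i, ∫ x, partialDeriv i f x ^ 2) + ∫ x, Δ f x ^ 2 := by
  have h1 : ‖toH f‖ ^ 2 = ∫ x, bessel f x * bessel f x := by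
    rw [← real_inner_self_eq_norm_sq, inner_toH]
    exact schwartzInner_eq f f
  have h2 : ∀ x, bessel f x * bessel f x = f x * f x - 2 * (f x * Δ f x) + Δ f x * Δ f x := by
    intro x
    simp only [bessel, sub_apply]
    ring
  rw [h1]
  simp only [h2]
  have h3 : Integrable fun x => f x * f x - 2 * (f x * Δ f x) :=
    (integrable_mul f f).sub ((integrable_mul f (Δ f)).const_mul 2)
  rw [integral_add h3 (integrable_mul (Δ f) (Δ f)),
    integral_sub (integrable_mul f f) ((integrable_mul f (Δ f)).const_mul 2),
    integral_const_mul, integral_mul_laplacian]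
  simp only [pow_two]
  ring

lemma integral_sq_nonneg (g : R4 → ℝ) : 0 ≤ ∫ x, g x ^ 2 := integral_nonneg fun _ => sq_nonneg _

lemma sqrt_integral_sq_le (f : 𝓢(R4, ℝ)) : √(∫ x, f x ^ 2) ≤ ‖toH f‖ := by
  refine Real.sqrt_le_iff.2 ⟨norm_nonneg _, ?_⟩
  rw [norm_toH_sq]
  have := Finset.sum_nonneg fun i (_ : i ∈ Finset.univ) => integral_sq_nonneg (partialDeriv i f)
  linarith [integral_sq_nonneg (Δ f : 𝓢(R4, ℝ))]

lemma sqrt_integral_laplacian_sq_le (f : 𝓢(R4, ℝ)) : √(∫ x, Δ f x ^ 2) ≤ ‖toH f‖ := by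
  refine Real.sqrt_le_iff.2 ⟨norm_nonneg _, ?_⟩
  rw [norm_toH_sq]
  have := Finset.sum_nonneg fun i (_ : i ∈ Finset.univ) => integral_sq_nonneg (partialDeriv i f)
  linarith [integral_sq_nonneg f]

lemma sqrt_integral_partialDeriv_sq_le (i : Fin 4) (f : 𝓢(R4, ℝ)) :
    √(∫ x, partialDeriv i f x ^ 2) ≤ ‖toH f‖ := by
  refine Real.sqrt_le_iff.2 ⟨norm_nonneg _, ?_⟩
  rw [norm_toH_sq]
  have h := Finset.single_le_sum (f := fun i => ∫ x, partialDeriv i f x ^ 2)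
    (fun i _ => integral_sq_nonneg (partialDeriv i f)) (Finset.mem_univ i)
  have := integral_sq_nonneg (partialDeriv i f)
  linarith [integral_sq_nonneg f, integral_sq_nonneg (Δ f : 𝓢(R4, ℝ))]

/-! ### Translation of truncated kernels in `L²`. -/

lemma abs_integral_mul_le {a b : R4 → ℝ} (ha : MemLp a 2) (hb : MemLp b 2) :
    |∫ x, a x * b x| ≤ √(∫ x, a x ^ 2) * √(∫ x, b x ^ 2) := by
  have h := integral_mul_norm_le_Lp_mul_Lq (μ := (volume : Measure R4)) (f := a) (g := b)
    Real.HolderConjugate.two_two (by simpa using ha) (by simpa using hb)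
  refine (norm_integral_le_integral_norm fun x => a x * b x).trans ?_
  simp only [norm_mul]
  refine h.trans (le_of_eq ?_)
  rw [Real.sqrt_eq_rpow, Real.sqrt_eq_rpow]
  simp

/-- The ball about `x` of radius `ε - ‖x - y‖` lies in the ball about `y`, so the difference sits in
a shell of volume proportional to `ε⁴ - (ε - ‖x - y‖)⁴`. When `‖x - y‖ ≥ ε`, the whole ball already
satisfies the bound. -/
lemma measureReal_ball_diff_ball_le {ε : ℝ} (hε : 0 < ε) (x y : R4) :
    (volume : Measure R4).real (Metric.ball x ε \ Metric.ball y ε)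
      ≤ 4 * ε ^ 3 * (volume : Measure R4).real (Metric.ball 0 1) * ‖x - y‖ := by
  set ω := (volume : Measure R4).real (Metric.ball 0 1)
  have hball : ∀ r, 0 ≤ r → (volume : Measure R4).real (Metric.ball x r) = r ^ 4 * ω := by
    intro r hr
    rw [measureReal_def, Measure.addHaar_ball _ _ hr, ENNReal.toReal_mul,
      ENNReal.toReal_ofReal (by positivity), finrank_euclideanSpace_fin]
    rfl
  have hω : 0 ≤ ω := measureReal_nonneg
  rcases le_total ‖x - y‖ ε with h | h
  · have hsub : Metric.ball x ε \ Metric.ball y ε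
        ⊆ Metric.ball x ε \ Metric.ball x (ε - ‖x - y‖) := by
      refine sdiff_subset_sdiff_right fun z hz => ?_
      rw [Metric.mem_ball] at hz ⊢
      linarith [dist_triangle z x y, dist_eq_norm x y]
    refine (measureReal_mono hsub (measure_ne_top_of_subset sdiff_subset
      measure_ball_lt_top.ne)).trans ?_
    rw [measureReal_sdiff (Metric.ball_subset_ball (by linarith [norm_nonneg (x - y)]))
      measurableSet_ball measure_ball_lt_top.ne, hball ε hε.le, hball _ (sub_nonneg.2 h)]
    have h0 := norm_nonneg (x - y)
    generalize ‖x - y‖ = d at *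
    have : ε ^ 4 - (ε - d) ^ 4 ≤ 4 * ε ^ 3 * d := by
      nlinarith [sq_nonneg (d * (2 * ε - d)), mul_nonneg (sq_nonneg d) (sq_nonneg ε),
        mul_nonneg (mul_nonneg (sq_nonneg d) (sub_nonneg.2 h)) hε.le]
    nlinarith
  · refine (measureReal_mono sdiff_subset measure_ball_lt_top.ne).trans ?_
    rw [hball ε hε.le]
    have : ε ^ 4 ≤ 4 * ε ^ 3 * ‖x - y‖ := by
      have : 0 < ε ^ 3 := by positivity
      nlinarith
    nlinarith

/-- The kernel `ℓ` cut off outside the ball of radius `ε` and translated to the centre `x`. -/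
def ballKernel (ε : ℝ) (ℓ : R4 → ℝ) (x : R4) : R4 → ℝ :=
  (Metric.ball x ε).indicator fun z => ℓ (z - x)

lemma setIntegral_ball_mul_eq (ε : ℝ) (ℓ g : R4 → ℝ) (x : R4) :
    ∫ y in Metric.ball 0 ε, ℓ y * g (x + y) = ∫ z, ballKernel ε ℓ x z * g z := by
  rw [← integral_indicator measurableSet_ball,
    ← integral_add_left_eq_self (fun z => ballKernel ε ℓ x z * g z) x]
  refine integral_congr_ae (ae_of_all _ fun y => ?_)
  by_cases hy : y ∈ Metric.ball (0 : R4) ε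
  · have : x + y ∈ Metric.ball x ε := by simpa using hy
    simp [ballKernel, hy, this]
  · have : x + y ∉ Metric.ball x ε := by simpa using hy
    simp [ballKernel, hy, this]

section BallKernel

variable {ε K : ℝ} {ℓ : R4 → ℝ}

lemma abs_ballKernel_le (hK : 0 ≤ K) (hb : ∀ y ∈ Metric.ball (0 : R4) ε, |ℓ y| ≤ K) (x z : R4) :
    |ballKernel ε ℓ x z| ≤ K := by
  by_cases hz : z ∈ Metric.ball x ε
  · rw [ballKernel, indicator_of_mem hz]
    exact hb _ (by simpa [dist_eq_norm] using hz)
  · rw [ballKernel, indicator_of_notMem hz]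
    simpa using hK

lemma ballKernel_sq_le (hK : 0 ≤ K) (hb : ∀ y ∈ Metric.ball (0 : R4) ε, |ℓ y| ≤ K) (x z : R4) :
    ballKernel ε ℓ x z ^ 2 ≤ (Metric.ball x ε).indicator (fun _ => K ^ 2) z := by
  by_cases hz : z ∈ Metric.ball x ε
  · rw [indicator_of_mem hz, ← sq_abs]
    gcongr
    exact abs_ballKernel_le hK hb x z
  · simp [ballKernel, hz]

lemma memLp_ballKernel (hℓ : Continuous ℓ) (hK : 0 ≤ K)
    (hb : ∀ y ∈ Metric.ball (0 : R4) ε, |ℓ y| ≤ K) (x : R4) : MemLp (ballKernel ε ℓ x) 2 := by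
  have h1 : MemLp ((Metric.ball x ε).indicator fun _ => K) 2 (volume : Measure R4) :=
    memLp_indicator_const 2 measurableSet_ball K (Or.inr measure_ball_lt_top.ne)
  refine h1.mono ?_ (ae_of_all _ fun z => ?_)
  · exact ((hℓ.comp (continuous_id.sub continuous_const)).measurable.indicator
      measurableSet_ball).aestronglyMeasurable
  · by_cases hz : z ∈ Metric.ball x ε
    · rw [indicator_of_mem hz, Real.norm_eq_abs, Real.norm_of_nonneg hK]
      exact abs_ballKernel_le hK hb x z
    · simp [ballKernel, hz]

lemma integral_ballKernel_sq_le (hK : 0 ≤ K) (hb : ∀ y ∈ Metric.ball (0 : R4) ε, |ℓ y| ≤ K)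
    (x : R4) :
    ∫ z, ballKernel ε ℓ x z ^ 2 ≤ K ^ 2 * (volume : Measure R4).real (Metric.ball 0 ε) := by
  have h1 : Integrable ((Metric.ball x ε).indicator fun _ => K ^ 2) (volume : Measure R4) :=
    (integrable_indicator_iff measurableSet_ball).2 (integrableOn_const measure_ball_lt_top.ne)
  refine (integral_mono_of_nonneg (ae_of_all _ fun _ => sq_nonneg _) h1
    (ae_of_all _ (ballKernel_sq_le hK hb x))).trans ?_
  rw [integral_indicator_const _ measurableSet_ball, smul_eq_mul, mul_comm,
    Measure.addHaar_real_ball_center]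

/-- On the overlap of the balls the Lipschitz bound applies. On the two differences one kernel
vanishes and the other is at most `K`. -/
lemma ballKernel_sub_sq_le (hK : 0 ≤ K) (hε : 0 < ε)
    (hb : ∀ y ∈ Metric.ball (0 : R4) ε, |ℓ y| ≤ K)
    (hlip : ∀ y z, |ℓ y - ℓ z| ≤ K * ‖y - z‖) (x y z : R4) :
    (ballKernel ε ℓ x z - ballKernel ε ℓ y z) ^ 2
      ≤ (Metric.ball x ε).indicator (fun _ => 2 * ε * K ^ 2 * ‖x - y‖) z
        + (Metric.ball x ε \ Metric.ball y ε).indicator (fun _ => K ^ 2) z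
        + (Metric.ball y ε \ Metric.ball x ε).indicator (fun _ => K ^ 2) z := by
  by_cases hx : z ∈ Metric.ball x ε <;> by_cases hy : z ∈ Metric.ball y ε
  · have h1 : |ℓ (z - x) - ℓ (z - y)| ≤ K * ‖x - y‖ := by
      have := hlip (z - x) (z - y)
      rwa [sub_sub_sub_cancel_left, norm_sub_rev] at this
    -- The balls meet at `z`, so one factor of `‖x - y‖²` can be traded for `2ε`, leaving a bound
    -- linear in `‖x - y‖` like that for the differences.
    have h2 : ‖x - y‖ ≤ 2 * ε := by
      rw [← dist_eq_norm]
      rw [Metric.mem_ball] at hx hy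
      linarith [dist_triangle_left x y z]
    simp only [ballKernel, indicator_of_mem hx, indicator_of_mem hy, Set.mem_sdiff, hx, hy,
      not_true_eq_false, and_false, not_false_eq_true, indicator_of_notMem, add_zero]
    rw [← sq_abs]
    calc |ℓ (z - x) - ℓ (z - y)| ^ 2 ≤ (K * ‖x - y‖) ^ 2 := by gcongr
      _ = K ^ 2 * ‖x - y‖ * ‖x - y‖ := by ring
      _ ≤ K ^ 2 * ‖x - y‖ * (2 * ε) := by gcongr
      _ = _ := by ring
  · have h1 := ballKernel_sq_le hK hb x z
    have h2 : 0 ≤ 2 * ε * K ^ 2 * ‖x - y‖ := by positivity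
    have h3 : ballKernel ε ℓ y z = 0 := by simp [ballKernel, hy]
    rw [h3, sub_zero]
    simp only [indicator_of_mem hx, Set.mem_sdiff, hx, hy,
      not_true_eq_false, and_self, not_false_eq_true, indicator_of_notMem, add_zero,
      indicator_of_mem] at h1 ⊢
    linarith
  · have h1 := ballKernel_sq_le hK hb y z
    have h3 : ballKernel ε ℓ x z = 0 := by simp [ballKernel, hx]
    rw [h3, zero_sub, neg_sq]
    simpa [hx, hy] using h1
  · simp [ballKernel, hx, hy]

lemma integral_ballKernel_sub_sq_le (hK : 0 ≤ K) (hε : 0 < ε)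
    (hb : ∀ y ∈ Metric.ball (0 : R4) ε, |ℓ y| ≤ K)
    (hlip : ∀ y z, |ℓ y - ℓ z| ≤ K * ‖y - z‖) (x y : R4) :
    ∫ z, (ballKernel ε ℓ x z - ballKernel ε ℓ y z) ^ 2
      ≤ (2 * ε * K ^ 2 * (volume : Measure R4).real (Metric.ball 0 ε)
        + 2 * (4 * ε ^ 3 * (volume : Measure R4).real (Metric.ball 0 1) * K ^ 2)) * ‖x - y‖ := by
  have hint : ∀ (s : Set R4) (c : ℝ), MeasurableSet s → volume s ≠ ⊤ →
      Integrable (s.indicator fun _ => c) (volume : Measure R4) := fun s c hs hf =>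
    (integrable_indicator_iff hs).2 (integrableOn_const hf)
  have hfin : ∀ x y : R4, volume (Metric.ball x ε \ Metric.ball y ε) ≠ ⊤ := fun x y =>
    measure_ne_top_of_subset sdiff_subset measure_ball_lt_top.ne
  have hm : ∀ x y : R4, MeasurableSet (Metric.ball x ε \ Metric.ball y ε) := fun x y =>
    measurableSet_ball.diff measurableSet_ball
  have i1 := hint (Metric.ball x ε) (2 * ε * K ^ 2 * ‖x - y‖) measurableSet_ball
    measure_ball_lt_top.ne
  have i2 := hint _ (K ^ 2) (hm x y) (hfin x y)
  have i3 := hint _ (K ^ 2) (hm y x) (hfin y x)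
  have i12 : Integrable fun z => (Metric.ball x ε).indicator (fun _ => 2 * ε * K ^ 2 * ‖x - y‖) z
      + (Metric.ball x ε \ Metric.ball y ε).indicator (fun _ => K ^ 2) z := i1.add i2
  refine (integral_mono_of_nonneg (ae_of_all _ fun _ => sq_nonneg _) (i12.add i3)
    (ae_of_all _ (ballKernel_sub_sq_le hK hε hb hlip x y))).trans ?_
  simp only [Pi.add_apply]
  rw [integral_add i12 i3, integral_add i1 i2, integral_indicator_const _ measurableSet_ball,
    integral_indicator_const _ (hm x y), integral_indicator_const _ (hm y x),
    Measure.addHaar_real_ball_center]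
  simp only [smul_eq_mul]
  have h1 := mul_le_mul_of_nonneg_right (measureReal_ball_diff_ball_le hε x y) (sq_nonneg K)
  have h2 := mul_le_mul_of_nonneg_right (measureReal_ball_diff_ball_le hε y x) (sq_nonneg K)
  rw [norm_sub_rev y x] at h2
  linarith

/-- Averages of `g` against a Lipschitz kernel on the ball of radius `ε` around `x` are bounded in
terms of `‖g‖_{L²}`, and Hölder continuous of exponent `1/2` in `x`. -/
lemma exists_setIntegral_ball_bound (hε : 0 < ε) (hK : 0 ≤ K)
    (hb : ∀ y ∈ Metric.ball (0 : R4) ε, |ℓ y| ≤ K)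
    (hlip : ∀ y z, |ℓ y - ℓ z| ≤ K * ‖y - z‖) :
    ∃ C, 0 ≤ C ∧ ∀ g : 𝓢(R4, ℝ),
      (∀ x, |∫ y in Metric.ball 0 ε, ℓ y * g (x + y)| ≤ C * √(∫ z, g z ^ 2)) ∧
      ∀ x y, |(∫ z in Metric.ball 0 ε, ℓ z * g (x + z)) - ∫ z in Metric.ball 0 ε, ℓ z * g (y + z)|
        ≤ C * √‖x - y‖ * √(∫ z, g z ^ 2) := by
  have hℓ : Continuous ℓ := by
    refine (LipschitzWith.of_dist_le_mul (K := K.toNNReal) fun y z => ?_).continuous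
    rw [Real.dist_eq, dist_eq_norm, Real.coe_toNNReal _ hK]
    exact hlip y z
  set a := K ^ 2 * (volume : Measure R4).real (Metric.ball 0 ε)
  set b := 2 * ε * K ^ 2 * (volume : Measure R4).real (Metric.ball 0 ε)
        + 2 * (4 * ε ^ 3 * (volume : Measure R4).real (Metric.ball 0 1) * K ^ 2)
  refine ⟨√a + √b, by positivity, fun g => ?_⟩
  have hk := memLp_ballKernel hℓ hK hb
  have hg : MemLp g 2 := g.memLp 2
  have hkg : ∀ x, Integrable fun z => ballKernel ε ℓ x z * g z := fun x =>
    (hk x).integrable_mul hg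
  constructor
  · intro x
    rw [setIntegral_ball_mul_eq]
    refine (abs_integral_mul_le (hk x) hg).trans ?_
    gcongr
    exact (Real.sqrt_le_sqrt (integral_ballKernel_sq_le hK hb x)).trans
      (le_add_of_nonneg_right (Real.sqrt_nonneg _))
  · intro x y
    rw [setIntegral_ball_mul_eq, setIntegral_ball_mul_eq,
      ← integral_sub (hkg x) (hkg y)]
    simp only [← sub_mul]
    refine (abs_integral_mul_le ((hk x).sub (hk y)) hg).trans ?_
    gcongr
    refine (Real.sqrt_le_sqrt (integral_ballKernel_sub_sq_le hK hε hb hlip x y)).trans ?_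
    rw [Real.sqrt_mul (by positivity)]
    gcongr
    exact le_add_of_nonneg_left (Real.sqrt_nonneg _)

end BallKernel

end GFF4

/-! ### Polar coordinates and the divergence theorem on balls -/

namespace GFF4

/-- The unnormalized integral of `g (r u)` over the unit sphere. -/
def sphereIntegral (g : R4 → ℝ) (r : ℝ) : ℝ :=
  ∫ u : Metric.sphere (0 : R4) 1, g (r • (u : R4)) ∂sphereMeasure

lemma continuous_sphereIntegral {g : R4 → ℝ} (hg : Continuous g) :
    Continuous (sphereIntegral g) := by
  have h := continuous_parametric_integral_of_continuous (μ := sphereMeasure)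
    (f := fun (r : ℝ) (u : Metric.sphere (0 : R4) 1) => g (r • (u : R4)))
    (by fun_prop) isCompact_univ
  simp only [Measure.restrict_univ] at h
  exact h

lemma integral_polar {g : R4 → ℝ} (hg : Integrable g) :
    ∫ y, g y = ∫ r in Ioi (0 : ℝ), r ^ 3 * sphereIntegral g r := by
  have hmp := (volume : Measure R4).measurePreserving_homeomorphUnitSphereProd
  have hemb := (homeomorphUnitSphereProd R4).measurableEmbedding
  set G : Metric.sphere (0 : R4) 1 × Ioi (0 : ℝ) → ℝ := fun p => g ((p.2 : ℝ) • (p.1 : R4))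
  have hG : ∀ y : ({0}ᶜ : Set R4), G (homeomorphUnitSphereProd R4 y) = g y := fun y => by
    have h := homeomorphUnitSphereProd_symm_apply_coe R4 (homeomorphUnitSphereProd R4 y)
    rw [Homeomorph.symm_apply_apply] at h
    rw [h]
  have hdim : Module.finrank ℝ R4 - 1 = 3 := by rw [finrank_euclideanSpace_fin]
  rw [hdim] at hmp
  have hint : Integrable G ((volume : Measure R4).toSphere.prod (Measure.volumeIoiPow 3)) := by
    rw [← hmp.integrable_comp_emb hemb]
    have : G ∘ homeomorphUnitSphereProd R4 = g ∘ ((↑) : ({0}ᶜ : Set R4) → R4) := funext hG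
    rw [this, ← integrableOn_iff_comap_subtypeVal (measurableSet_singleton _).compl]
    exact hg.integrableOn
  calc ∫ y, g y = ∫ y : ({0}ᶜ : Set R4), g y ∂((volume : Measure R4).comap Subtype.val) := by
        rw [integral_subtype_comap (measurableSet_singleton _).compl g, restrict_compl_singleton]
    _ = ∫ p, G p ∂((volume : Measure R4).toSphere.prod (Measure.volumeIoiPow 3)) := by
        rw [← hmp.integral_comp hemb]
        simp only [hG]
    _ = ∫ r : Ioi (0 : ℝ), sphereIntegral g r ∂(Measure.volumeIoiPow 3) := by
        rw [integral_prod_symm _ hint]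
        rfl
    _ = _ := by
        simp only [Measure.volumeIoiPow, ENNReal.ofReal]
        rw [integral_withDensity_eq_integral_smul
          (measurable_subtype_coe.pow_const _).real_toNNReal,
          integral_subtype_comap measurableSet_Ioi
            fun a => Real.toNNReal (a ^ 3) • sphereIntegral g a]
        refine setIntegral_congr_fun measurableSet_Ioi fun r hr => ?_
        rw [NNReal.smul_def, Real.coe_toNNReal _ (pow_nonneg hr.out.le _), smul_eq_mul]

lemma setIntegral_ball_polar {g : R4 → ℝ} (hg : Continuous g) {η : ℝ → ℝ} (hη : Continuous η)
    {r : ℝ} (hr : 0 ≤ r) :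
    ∫ y in Metric.ball 0 r, η ‖y‖ * g y = ∫ s in (0)..r, η s * (s ^ 3 * sphereIntegral g s) := by
  have hc : Continuous fun y => η ‖y‖ * g y := by fun_prop
  have hint : Integrable ((Metric.ball (0 : R4) r).indicator fun y => η ‖y‖ * g y) := by
    rw [integrable_indicator_iff measurableSet_ball]
    exact (hc.continuousOn.integrableOn_compact (isCompact_closedBall 0 r)).mono_set
      Metric.ball_subset_closedBall
  rw [← integral_indicator measurableSet_ball, integral_polar hint,
    intervalIntegral.integral_of_le hr, integral_Ioc_eq_integral_Ioo,
    ← Ioi_inter_Iio, ← setIntegral_indicator measurableSet_Iio]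
  refine setIntegral_congr_fun measurableSet_Ioi fun s hs => ?_
  have hs0 : 0 < s := hs
  have hn : ∀ u : Metric.sphere (0 : R4) 1, ‖s • (u : R4)‖ = s := fun u => by
    simp [norm_smul, abs_of_pos hs0]
  by_cases hsr : s < r
  · have hmem : ∀ u : Metric.sphere (0 : R4) 1, s • (u : R4) ∈ Metric.ball (0 : R4) r := fun u => by
      rw [mem_ball_zero_iff, hn]
      exact hsr
    simp only [sphereIntegral, indicator_of_mem (hmem _), hn, integral_const_mul]
    rw [indicator_of_mem (show s ∈ Iio r from hsr)]
    ring
  · have hmem : ∀ u : Metric.sphere (0 : R4) 1, s • (u : R4) ∉ Metric.ball (0 : R4) r := fun u => by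
      rw [mem_ball_zero_iff, hn]
      exact hsr
    simp only [sphereIntegral, indicator_of_notMem (hmem _), integral_zero, mul_zero]
    rw [indicator_of_notMem (show s ∉ Iio r from hsr)]

/-! ### The divergence theorem by way of a radial cutoff. -/

lemma hasDerivAt_max_zero_sq (t : ℝ) :
    HasDerivAt (fun t : ℝ => max t 0 ^ 2) (2 * max t 0) t := by
  rcases lt_trichotomy t 0 with h | rfl | h
  · rw [max_eq_right h.le, mul_zero]
    refine (hasDerivAt_const t (0 : ℝ)).congr_of_eventuallyEq ?_
    filter_upwards [gt_mem_nhds h] with s hs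
    simp [max_eq_right (le_of_lt hs)]
  · have h : HasDerivAt (fun t : ℝ => max t 0 ^ 2) 0 0 := by
      rw [hasDerivAt_iff_isLittleO_nhds_zero]
      have h1 : (fun t : ℝ => max (0 + t) 0 ^ 2 - max 0 0 ^ 2 - t • (0 : ℝ))
          =O[𝓝 0] fun t : ℝ => t ^ 2 := by
        refine Asymptotics.isBigO_of_le _ fun t => ?_
        simp only [zero_add, max_self, smul_zero, sub_zero, norm_pow, ne_eq, OfNat.ofNat_ne_zero,
          not_false_eq_true, zero_pow]
        gcongr
        rw [Real.norm_of_nonneg (le_max_right _ _)]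
        exact max_le (le_abs_self t) (abs_nonneg t)
      refine h1.trans_isLittleO ?_
      simpa using Asymptotics.isLittleO_pow_id (𝕜 := ℝ) (n := 2) (by norm_num)
    simpa using h
  · rw [max_eq_left h.le]
    have h1 : HasDerivAt (fun t : ℝ => t ^ 2) (2 * t) t := by simpa using hasDerivAt_pow 2 t
    refine h1.congr_of_eventuallyEq ?_
    filter_upwards [lt_mem_nhds h] with s hs
    simp [max_eq_left (le_of_lt hs)]

/-- Squaring the positive part makes the cutoff differentiable across the sphere as well, so
integration by parts over the whole space has no boundary term. -/
lemma hasFDerivAt_cutoff (r : ℝ) (y : R4) :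
    HasFDerivAt (fun y : R4 => max (r ^ 2 - ‖y‖ ^ 2) 0 ^ 2)
      ((2 * max (r ^ 2 - ‖y‖ ^ 2) 0) • (-((2 : ℕ) • (innerSL ℝ y : R4 →L[ℝ] ℝ)))) y := by
  have h1 : HasFDerivAt (fun y : R4 => r ^ 2 - ‖y‖ ^ 2) (-((2 : ℕ) • (innerSL ℝ y : R4 →L[ℝ] ℝ))) y :=
    (hasStrictFDerivAt_norm_sq y).hasFDerivAt.const_sub _
  exact (hasDerivAt_max_zero_sq (r ^ 2 - ‖y‖ ^ 2)).comp_hasFDerivAt y h1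

lemma integral_cutoff_eq_setIntegral {r : ℝ} (hr : 0 < r) {n : ℕ} (hn : n ≠ 0) (g : R4 → ℝ) :
    ∫ y, max (r ^ 2 - ‖y‖ ^ 2) 0 ^ n * g y
      = ∫ y in Metric.ball 0 r, (r ^ 2 - ‖y‖ ^ 2) ^ n * g y := by
  rw [← integral_indicator measurableSet_ball]
  refine integral_congr_ae (ae_of_all _ fun y => ?_)
  simp only
  by_cases hy : y ∈ Metric.ball (0 : R4) r
  · rw [indicator_of_mem hy, max_eq_left]
    rw [mem_ball_zero_iff] at hy
    have := norm_nonneg y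
    nlinarith
  · rw [indicator_of_notMem hy, max_eq_right, zero_pow hn, zero_mul]
    rw [mem_ball_zero_iff, not_lt] at hy
    nlinarith

lemma hasCompactSupport_cutoff {r : ℝ} (hr : 0 < r) {n : ℕ} (hn : n ≠ 0) :
    HasCompactSupport fun y : R4 => max (r ^ 2 - ‖y‖ ^ 2) 0 ^ n := by
  refine HasCompactSupport.intro (isCompact_closedBall 0 r) fun y hy => ?_
  rw [mem_closedBall_zero_iff, not_le] at hy
  rw [max_eq_right (by nlinarith), zero_pow hn]

/-- Integration by parts against the cutoff `(r² - |y|²)₊²`. -/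
lemma integral_cutoff_mul_laplacian {r : ℝ} (hr : 0 < r) (f : 𝓢(R4, ℝ)) (x : R4) :
    ∫ y in Metric.ball 0 r, (r ^ 2 - ‖y‖ ^ 2) ^ 2 * Δ f (x + y)
      = 4 * ∫ y in Metric.ball 0 r, (r ^ 2 - ‖y‖ ^ 2) * fderiv ℝ f (x + y) y := by
  set η : R4 → ℝ := fun y => max (r ^ 2 - ‖y‖ ^ 2) 0 ^ 2 with hη
  have hηc : Continuous η := by fun_prop
  have hηs : HasCompactSupport η := hasCompactSupport_cutoff hr two_ne_zero
  have hmc : Continuous fun y : R4 => max (r ^ 2 - ‖y‖ ^ 2) 0 := by fun_prop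
  have hms : HasCompactSupport fun y : R4 => max (r ^ 2 - ‖y‖ ^ 2) 0 := by
    simpa using hasCompactSupport_cutoff hr one_ne_zero
  have hηint : ∀ g : R4 → ℝ, Continuous g → Integrable fun y => η y * g y := fun g hg =>
    (hηc.mul hg).integrable_of_hasCompactSupport hηs.mul_right
  have hmint : ∀ g : R4 → ℝ, Continuous g →
      Integrable fun y : R4 => max (r ^ 2 - ‖y‖ ^ 2) 0 * g y := fun g hg =>
    (hmc.mul hg).integrable_of_hasCompactSupport hms.mul_right
  have hηd : ∀ (y : R4) (i : Fin 4), fderiv ℝ η y (EuclideanSpace.basisFun (Fin 4) ℝ i)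
      = -4 * (max (r ^ 2 - ‖y‖ ^ 2) 0 * y i) := fun y i => by
    rw [(hasFDerivAt_cutoff r y).fderiv]
    simp [EuclideanSpace.inner_single_right]
    ring
  have hshift : ∀ (g : 𝓢(R4, ℝ)) (y : R4) (i : Fin 4),
      fderiv ℝ (fun y => g (x + y)) y (EuclideanSpace.basisFun (Fin 4) ℝ i)
        = partialDeriv i g (x + y) := fun g y i => by
    rw [fderiv_comp_add_left, partialDeriv_apply]
  have hparts : ∀ i, ∫ y, η y * partialDeriv i (partialDeriv i f) (x + y)
      = 4 * ∫ y : R4, max (r ^ 2 - ‖y‖ ^ 2) 0 * (y i * partialDeriv i f (x + y)) := fun i => by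
    have hc1 : Continuous fun y : R4 => partialDeriv i f (x + y) :=
      (partialDeriv i f).continuous.comp (by fun_prop)
    have hc2 : Continuous fun y : R4 => partialDeriv i (partialDeriv i f) (x + y) :=
      (partialDeriv i (partialDeriv i f)).continuous.comp (by fun_prop)
    have hc3 : Continuous fun y : R4 => y i * partialDeriv i f (x + y) := by fun_prop
    have h := integral_mul_fderiv_eq_neg_fderiv_mul_of_integrable (μ := (volume : Measure R4))
      (f := η) (g := fun y => partialDeriv i f (x + y))
      (v := EuclideanSpace.basisFun (Fin 4) ℝ i) ?_ ?_ ?_ ?_ ?_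
    · simp only [hshift, hηd] at h
      rw [h, ← integral_neg, ← integral_const_mul]
      congr 1
      ext y
      ring
    · simp only [hηd]
      refine ((hmint _ hc3).const_mul (-4)).congr (ae_of_all _ fun y => ?_)
      simp only
      ring
    · simp only [hshift]
      exact hηint _ hc2
    · exact hηint _ hc1
    · exact fun y _ => (hasFDerivAt_cutoff r y).differentiableAt
    · intro y _
      exact (partialDeriv i f).differentiableAt.comp y (by fun_prop)
  have h1 : ∫ y, η y * Δ f (x + y) = 4 * ∫ y : R4, max (r ^ 2 - ‖y‖ ^ 2) 0 ^ 1
      * fderiv ℝ f (x + y) y := by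
    simp only [laplacian_eq_sum_partialDeriv, _root_.sum_apply, Finset.mul_sum,
      fderiv_apply_eq_sum, pow_one]
    rw [integral_finsetSum, integral_finsetSum, Finset.mul_sum]
    · exact Finset.sum_congr rfl fun i _ => hparts i
    · exact fun i _ => hmint _ (by
        have := (partialDeriv i f).continuous
        fun_prop)
    · exact fun i _ => hηint _ ((partialDeriv i (partialDeriv i f)).continuous.comp (by fun_prop))
  rw [integral_cutoff_eq_setIntegral hr one_ne_zero, integral_cutoff_eq_setIntegral hr two_ne_zero]
    at h1
  simpa only [pow_one] using h1

/-- The weight vanishes at `s = r`, so the moving endpoint contributes nothing and only the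
derivative `2r` of the weight remains. Expanding the weight takes `r` out of the integral. -/
lemma hasDerivAt_integral_sub_sq_mul {h : ℝ → ℝ} (hh : Continuous h) (r : ℝ) :
    HasDerivAt (fun r => ∫ s in (0)..r, (r ^ 2 - s ^ 2) * h s) (2 * r * ∫ s in (0)..r, h s) r := by
  have hF : ∀ g : ℝ → ℝ, Continuous g →
      HasDerivAt (fun r => ∫ s in (0)..r, g s) (g r) r := fun g hg =>
    intervalIntegral.integral_hasDerivAt_right (hg.intervalIntegrable _ _)
      hg.aestronglyMeasurable.stronglyMeasurableAtFilter hg.continuousAt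
  have h2 : Continuous fun s => s ^ 2 * h s := by fun_prop
  have heq : (fun r : ℝ => ∫ s in (0)..r, (r ^ 2 - s ^ 2) * h s)
      = fun r => r ^ 2 * (∫ s in (0)..r, h s) - ∫ s in (0)..r, s ^ 2 * h s := by
    ext r
    simp only [sub_mul]
    rw [intervalIntegral.integral_sub ((hh.const_mul _).intervalIntegrable _ _)
      (h2.intervalIntegrable _ _), intervalIntegral.integral_const_mul]
  rw [heq]
  refine (((hasDerivAt_pow 2 r).mul (hF h hh)).sub (hF _ h2)).congr_deriv ?_
  simp

lemma hasDerivAt_integral_sub_sq_sq_mul {h : ℝ → ℝ} (hh : Continuous h) (r : ℝ) :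
    HasDerivAt (fun r => ∫ s in (0)..r, (r ^ 2 - s ^ 2) ^ 2 * h s)
      (4 * r * ∫ s in (0)..r, (r ^ 2 - s ^ 2) * h s) r := by
  have h2 : Continuous fun s => s ^ 2 * h s := by fun_prop
  -- Splitting one factor, `(r² - s²)² = r² (r² - s²) - (r² - s²) s²`, reduces to the singly
  -- weighted case.
  have heq : ∀ r : ℝ, ∫ s in (0)..r, (r ^ 2 - s ^ 2) ^ 2 * h s
      = r ^ 2 * (∫ s in (0)..r, (r ^ 2 - s ^ 2) * h s)
        - ∫ s in (0)..r, (r ^ 2 - s ^ 2) * (s ^ 2 * h s) := by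
    intro r
    rw [← intervalIntegral.integral_const_mul, ← intervalIntegral.integral_sub]
    · congr 1
      ext s
      ring
    · exact Continuous.intervalIntegrable (by fun_prop) _ _
    · exact Continuous.intervalIntegrable (by fun_prop) _ _
  have heq2 : ∫ s in (0)..r, (r ^ 2 - s ^ 2) * h s
      = r ^ 2 * (∫ s in (0)..r, h s) - ∫ s in (0)..r, s ^ 2 * h s := by
    simp only [sub_mul]
    rw [intervalIntegral.integral_sub ((hh.const_mul _).intervalIntegrable _ _)
      (h2.intervalIntegrable _ _), intervalIntegral.integral_const_mul]
  rw [funext heq]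
  refine (((hasDerivAt_pow 2 r).mul (hasDerivAt_integral_sub_sq_mul hh r)).sub
    (hasDerivAt_integral_sub_sq_mul h2 r)).congr_deriv ?_
  rw [heq2]
  simp
  ring

/-- Differentiating twice in `r` removes the weights. -/
lemma mul_integral_eq_of_weighted {a b : ℝ → ℝ} (ha : Continuous a) (hb : Continuous b)
    (h : ∀ r, 0 < r → ∫ s in (0)..r, (r ^ 2 - s ^ 2) ^ 2 * a s
      = 4 * ∫ s in (0)..r, (r ^ 2 - s ^ 2) * b s) {r : ℝ} (hr : 0 < r) :
    r * ∫ s in (0)..r, a s = b r := by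
  have h1 : ∀ r, 0 < r → ∫ s in (0)..r, (r ^ 2 - s ^ 2) * a s = 2 * ∫ s in (0)..r, b s := by
    intro r hr
    have hev : (fun r => ∫ s in (0)..r, (r ^ 2 - s ^ 2) ^ 2 * a s)
        =ᶠ[𝓝 r] fun r => 4 * ∫ s in (0)..r, (r ^ 2 - s ^ 2) * b s := by
      filter_upwards [lt_mem_nhds hr] with r hr using h r hr
    have h2 := (hasDerivAt_integral_sub_sq_sq_mul ha r).unique
      (((hasDerivAt_integral_sub_sq_mul hb r).const_mul 4).congr_of_eventuallyEq hev)
    have h3 : (4 * r) * (∫ s in (0)..r, (r ^ 2 - s ^ 2) * a s)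
        = (4 * r) * (2 * ∫ s in (0)..r, b s) := by linarith
    exact mul_left_cancel₀ (by positivity) h3
  have hev : (fun r => ∫ s in (0)..r, (r ^ 2 - s ^ 2) * a s)
      =ᶠ[𝓝 r] fun r => 2 * ∫ s in (0)..r, b s := by
    filter_upwards [lt_mem_nhds hr] with r hr using h1 r hr
  have hB : HasDerivAt (fun r => ∫ s in (0)..r, b s) (b r) r :=
    intervalIntegral.integral_hasDerivAt_right (hb.intervalIntegrable _ _)
      hb.aestronglyMeasurable.stronglyMeasurableAtFilter hb.continuousAt
  have h2 := (hasDerivAt_integral_sub_sq_mul ha r).unique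
    ((hB.const_mul 2).congr_of_eventuallyEq hev)
  linarith

lemma continuous_fderiv_apply (f : 𝓢(R4, ℝ)) (x : R4) :
    Continuous fun y => fderiv ℝ f (x + y) y := by
  have hf' : Continuous (fderiv ℝ f) := (f.smooth 1).continuous_fderiv one_ne_zero
  fun_prop

/-- The divergence theorem for the gradient of `f` on a ball. -/
lemma mul_setIntegral_laplacian {r : ℝ} (hr : 0 < r) (f : 𝓢(R4, ℝ)) (x : R4) :
    r * ∫ y in Metric.ball 0 r, Δ f (x + y)
      = r ^ 3 * sphereIntegral (fun y => fderiv ℝ f (x + y) y) r := by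
  have hc1 : Continuous fun y => Δ f (x + y) := (Δ f).continuous.comp (by fun_prop)
  have hc2 := continuous_fderiv_apply f x
  have hs1 := continuous_sphereIntegral hc1
  have hs2 := continuous_sphereIntegral hc2
  have h := mul_integral_eq_of_weighted
    (a := fun s => s ^ 3 * sphereIntegral (fun y => Δ f (x + y)) s)
    (b := fun s => s ^ 3 * sphereIntegral (fun y => fderiv ℝ f (x + y) y) s)
    (by fun_prop) (by fun_prop) (fun r hr => by
      rw [← setIntegral_ball_polar hc1 (η := fun s => (r ^ 2 - s ^ 2) ^ 2) (by fun_prop) hr.le,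
        ← setIntegral_ball_polar hc2 (η := fun s => r ^ 2 - s ^ 2) (by fun_prop) hr.le]
      exact integral_cutoff_mul_laplacian hr f x) hr
  rw [← h]
  congr 1
  simpa using setIntegral_ball_polar hc1 (η := fun _ => 1) continuous_const hr.le

/-! ### Integrals over the solid ball for `dσ` and `σ`. -/

lemma mul_sphereMean_deriv (f : 𝓢(R4, ℝ)) (x : R4) (r : ℝ) :
    r * ∫ u : Metric.sphere (0 : R4) 1, fderiv ℝ f (x + r • (u : R4)) (u : R4) ∂sphereMeasure
      = sphereIntegral (fun y => fderiv ℝ f (x + y) y) r := by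
  rw [sphereIntegral, ← integral_const_mul]
  simp

/-- The radial derivative of the mean is the normalized flux of `∇f` through the sphere, hence an
integral of `Δ f` over the ball. No second derivative other than `Δ f` enters. -/
lemma dsigma_apply_eq {ε : ℝ} (hε : 0 < ε) (x : R4) (f : 𝓢(R4, ℝ)) :
    dsigma x ε f = (2 * Real.pi ^ 2)⁻¹ * (ε ^ 3)⁻¹ * ∫ y in Metric.ball 0 ε, Δ f (x + y) := by
  have h1 : dsigma x ε f = (2 * Real.pi ^ 2)⁻¹ * ∫ u : Metric.sphere (0 : R4) 1,
      fderiv ℝ f (x + ε • (u : R4)) (u : R4) ∂sphereMeasure :=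
    (hasDerivAt_sphereMean x ε f).deriv
  have h2 := mul_setIntegral_laplacian hε f x
  rw [← mul_sphereMean_deriv] at h2
  rw [h1, mul_assoc]
  congr 1
  rw [eq_inv_mul_iff_mul_eq₀ (by positivity)]
  refine mul_left_cancel₀ hε.ne' ?_
  rw [h2]
  ring

/-- The fundamental theorem of calculus is applied to `r ^ 4 * sphereMean x r f`. The factor `r⁴`
kills the value at `0`, and leaves in the derivative the Jacobian `r³` of polar coordinates times
spherical integrals of `4 f` and `y · ∇f`. -/
lemma sigma_apply_eq {ε : ℝ} (hε : 0 < ε) (x : R4) (f : 𝓢(R4, ℝ)) :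
    sigma x ε f = (2 * Real.pi ^ 2)⁻¹ * (ε ^ 4)⁻¹ *
      (4 * (∫ y in Metric.ball 0 ε, f (x + y)) +
        ∑ i, ∫ y in Metric.ball 0 ε, y i * partialDeriv i f (x + y)) := by
  set c := (2 * Real.pi ^ 2)⁻¹
  have hc1 : Continuous fun y => f (x + y) := f.continuous.comp (by fun_prop)
  have hc2 := continuous_fderiv_apply f x
  have hs1 := continuous_sphereIntegral hc1
  have hs2 := continuous_sphereIntegral hc2
  have hσ : ∀ r, sphereMean x r f = c * sphereIntegral (fun y => f (x + y)) r := fun r => rfl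
  have hd : ∀ r, HasDerivAt (fun r => r ^ 4 * sphereMean x r f)
      (c * (4 * (r ^ 3 * sphereIntegral (fun y => f (x + y)) r)
        + r ^ 3 * sphereIntegral (fun y => fderiv ℝ f (x + y) y) r)) r := fun r => by
    refine ((hasDerivAt_pow 4 r).mul (hasDerivAt_sphereMean x r f)).congr_deriv ?_
    rw [← mul_sphereMean_deriv, hσ]
    push_cast
    ring
  have h1 := intervalIntegral.integral_eq_sub_of_hasDerivAt (a := 0) (b := ε) (fun r _ => hd r)
    (Continuous.intervalIntegrable (by fun_prop) _ _)
  have h2 : ∫ y in Metric.ball 0 ε, f (x + y)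
      = ∫ s in (0)..ε, s ^ 3 * sphereIntegral (fun y => f (x + y)) s := by
    simpa using setIntegral_ball_polar hc1 (η := fun _ => 1) continuous_const hε.le
  have h3 : ∑ i, ∫ y in Metric.ball 0 ε, y i * partialDeriv i f (x + y)
      = ∫ s in (0)..ε, s ^ 3 * sphereIntegral (fun y => fderiv ℝ f (x + y) y) s := by
    have h4 := setIntegral_ball_polar hc2 (η := fun _ => 1) continuous_const hε.le
    simp only [one_mul] at h4
    rw [← h4]
    simp only [fderiv_apply_eq_sum]
    rw [integral_finsetSum]
    intro i _
    have hcont : Continuous fun y : R4 => y i * partialDeriv i f (x + y) := by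
      have := (partialDeriv i f).continuous
      fun_prop
    exact (hcont.continuousOn.integrableOn_compact (isCompact_closedBall 0 ε)).mono_set
      Metric.ball_subset_closedBall
  rw [intervalIntegral.integral_const_mul, intervalIntegral.integral_add
    (Continuous.intervalIntegrable (by fun_prop) _ _)
    (Continuous.intervalIntegrable (by fun_prop) _ _), intervalIntegral.integral_const_mul,
    ← h2, ← h3] at h1
  have h5 : sigma x ε f = sphereMean x ε f := rfl
  rw [h5, mul_comm c, mul_assoc, h1]
  field_simp
  ring

end GFF4

/-! ### Bounds for `μ_ε^x` in `H⁻²` -/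

namespace GFF4

/-- `ν^x` is bounded in `H⁻²` uniformly in `x`, and Hölder continuous of exponent `1/2` in `x`. -/
def IsHalfHolderFamily (ν : R4 → 𝓢(R4, ℝ) → ℝ) : Prop :=
  ∃ C, 0 ≤ C ∧ ∀ f : 𝓢(R4, ℝ), (∀ x, |ν x f| ≤ C * ‖toH f‖) ∧
    ∀ x y, |ν x f - ν y f| ≤ C * √‖x - y‖ * ‖toH f‖

namespace IsHalfHolderFamily

variable {ν ν' : R4 → 𝓢(R4, ℝ) → ℝ}

lemma add (h : IsHalfHolderFamily ν) (h' : IsHalfHolderFamily ν') :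
    IsHalfHolderFamily fun x f => ν x f + ν' x f := by
  obtain ⟨C, hC, h⟩ := h
  obtain ⟨C', hC', h'⟩ := h'
  refine ⟨C + C', by positivity, fun f => ⟨fun x => ?_, fun x y => ?_⟩⟩
  · refine (abs_add_le _ _).trans ?_
    linarith [(h f).1 x, (h' f).1 x]
  · rw [add_sub_add_comm]
    refine (abs_add_le _ _).trans ?_
    linarith [(h f).2 x y, (h' f).2 x y]

lemma const_mul (h : IsHalfHolderFamily ν) (c : ℝ) :
    IsHalfHolderFamily fun x f => c * ν x f := by
  obtain ⟨C, hC, h⟩ := h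
  refine ⟨|c| * C, by positivity, fun f => ⟨fun x => ?_, fun x y => ?_⟩⟩
  · rw [abs_mul, mul_assoc]
    exact mul_le_mul_of_nonneg_left ((h f).1 x) (abs_nonneg c)
  · rw [← mul_sub, abs_mul, mul_assoc, mul_assoc, ← mul_assoc C]
    exact mul_le_mul_of_nonneg_left ((h f).2 x y) (abs_nonneg c)

lemma finset_sum {κ : Type*} {s : Finset κ} {ν : κ → R4 → 𝓢(R4, ℝ) → ℝ}
    (h : ∀ i, IsHalfHolderFamily (ν i)) : IsHalfHolderFamily fun x f => ∑ i ∈ s, ν i x f := by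
  classical
  induction s using Finset.induction_on with
  | empty => exact ⟨0, le_rfl, by simp⟩
  | insert i s hi ih => simpa only [Finset.sum_insert hi] using (h i).add ih

lemma of_ballKernel {ε K : ℝ} {ℓ : R4 → ℝ} (hε : 0 < ε) (hK : 0 ≤ K)
    (hb : ∀ y ∈ Metric.ball (0 : R4) ε, |ℓ y| ≤ K)
    (hlip : ∀ y z, |ℓ y - ℓ z| ≤ K * ‖y - z‖) {D : 𝓢(R4, ℝ) → 𝓢(R4, ℝ)}
    (hD : ∀ f, √(∫ x, D f x ^ 2) ≤ ‖toH f‖) :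
    IsHalfHolderFamily fun x f => ∫ y in Metric.ball 0 ε, ℓ y * D f (x + y) := by
  obtain ⟨C, hC, h⟩ := exists_setIntegral_ball_bound hε hK hb hlip
  refine ⟨C, hC, fun f => ⟨fun x => ((h (D f)).1 x).trans ?_, fun x y =>
    ((h (D f)).2 x y).trans ?_⟩⟩
  · gcongr
    exact hD f
  · gcongr
    exact hD f

lemma of_ball {ε : ℝ} (hε : 0 < ε) {D : 𝓢(R4, ℝ) → 𝓢(R4, ℝ)}
    (hD : ∀ f, √(∫ x, D f x ^ 2) ≤ ‖toH f‖) :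
    IsHalfHolderFamily fun x f => ∫ y in Metric.ball 0 ε, D f (x + y) := by
  simpa only [one_mul] using of_ballKernel (ℓ := fun _ => 1) (K := 1) hε zero_le_one
    (by simp) (by simp) hD

end IsHalfHolderFamily

lemma isHalfHolderFamily_sigma {ε : ℝ} (hε : 0 < ε) :
    IsHalfHolderFamily fun x f => sigma x ε f := by
  simp only [sigma_apply_eq hε]
  refine IsHalfHolderFamily.const_mul (IsHalfHolderFamily.add (IsHalfHolderFamily.const_mul
    (IsHalfHolderFamily.of_ball hε (D := fun f => f) sqrt_integral_sq_le) _)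
    (IsHalfHolderFamily.finset_sum fun i => ?_)) _
  -- A single constant `K` has to serve twice: `ε` bounds the coordinate on the ball, and `1` is its
  -- Lipschitz constant.
  refine IsHalfHolderFamily.of_ballKernel (ℓ := fun y : R4 => y i) (K := max 1 ε) hε
    (by positivity) (fun y hy => ?_) (fun y z => ?_) (sqrt_integral_partialDeriv_sq_le i)
  · rw [mem_ball_zero_iff] at hy
    exact (PiLp.norm_apply_le y i).trans (hy.le.trans (le_max_right _ _))
  · refine (PiLp.norm_apply_le (y - z) i).trans ?_
    exact le_mul_of_one_le_left (norm_nonneg _) (le_max_left _ _)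

lemma isHalfHolderFamily_dsigma {ε : ℝ} (hε : 0 < ε) :
    IsHalfHolderFamily fun x f => dsigma x ε f := by
  simp only [dsigma_apply_eq hε]
  exact (IsHalfHolderFamily.of_ball hε sqrt_integral_laplacian_sq_le).const_mul _

/-- The entries of `coeff ε` do not depend on `x`, so they affect only the constant. -/
lemma isHalfHolderFamily_mu {ε : ℝ} (hε : 0 < ε) : IsHalfHolderFamily fun x f => mu x ε f :=
  ((isHalfHolderFamily_sigma hε).const_mul (coeff ε 0)).add
    ((isHalfHolderFamily_dsigma hε).const_mul (coeff ε 1))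

end GFF4

end

theorem corollary2p3 {Θ : Type*} [NormedAddCommGroup Θ] [NormedSpace ℝ Θ] [CompleteSpace Θ]
    [TopologicalSpace.SeparableSpace Θ] [MeasurableSpace Θ] [BorelSpace Θ]
    (ι : GFF4.H →L[ℝ] Θ) (W : Measure Θ) (hW : GFF4.IsAbstractWienerSpace ι W)
    (ε : ℝ) (hε : 0 < ε) :
    (∀ (x : GFF4.R4) (f : 𝓢(GFF4.R4, ℝ)),
      inner ℝ (GFF4.toH f) (GFF4.riesz (GFF4.mu x ε)) = GFF4.mu x ε f) ∧
    Continuous (fun x : GFF4.R4 => hW.paleyWiener (GFF4.riesz (GFF4.mu x ε))) ∧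
    ∃ X : GFF4.R4 → Θ → ℝ,
      (∀ x, Measurable (X x) ∧ X x =ᵐ[W] hW.paleyWiener (GFF4.riesz (GFF4.mu x ε))) ∧
      ∀ α : ℝ≥0, 0 < α → α < 1 / 2 →
        ∀ᵐ θ ∂W, ∀ S : Set GFF4.R4, IsCompact S →
          ∃ C : ℝ≥0, HolderOnWith C α (fun x => X x θ) S := by
  obtain ⟨C, hC, h⟩ := GFF4.isHalfHolderFamily_mu hε
  -- Membership in `H⁻²`: this bound makes `riesz (mu x ε)` the true representer instead of the
  -- default value `0`.
  have hb : ∀ x, ∃ C, ∀ f, ‖GFF4.mu x ε f‖ ≤ C * ‖GFF4.toH f‖ := fun x => ⟨C, fun f => (h f).1 x⟩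
  have hh : ∀ x y, ‖GFF4.riesz (GFF4.mu x ε) - GFF4.riesz (GFF4.mu y ε)‖ ≤ C * √‖x - y‖ :=
    fun x y => GFF4.norm_riesz_sub_le (hb x) (hb y) (by positivity) fun f => (h f).2 x y
  exact ⟨fun x f => GFF4.inner_toH_riesz (hb x) f,
    hW.paleyWiener.continuous.comp (GFF4.continuous_of_norm_sub_le hh),
    GFF4.exists_holder_modification hW _ hC hh⟩
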